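/- For each $n\ge 1$ let $p=p_n$ be a natural number and let $\mathbf X_1,\dots,\mathbf X_{p}$ be independent random vectors in $\mathbb R^n$ with a common spherical distribution, possibly depending on $n$ (that is, $\mathbf O\mathbf X_1$ and $\mathbf X_1$ have the same law for every orthogonal $n\times n$ matrix $\mathbf O$), such that $P(\mathbf X_1=\mathbf 0)=0$. Put $$\tilde\rho_{ij}=\frac{(\mathbf X_i-\mu_i)^T(\mathbf X_j-\mu_j)}{\|\mathbf X_i-\mu_i\|\,\|\mathbf X_j-\mu_j\|},\qquad \tilde L_n=\max_{1\le i<j\le p}|\tilde\rho_{ij}|,\qquad \tilde T_n=\log(1-\tilde L_n^2),$$ where $\|\cdot\|$ is the Euclidean norm and $\mu_i=E\mathbf X_i$ if this mean exists and $\mu_i=\mathbf 0$ otherwise (by symmetry the mean is $\mathbf 0$ whenever it exists). Suppose that $(\log p_n)/n\to\infty$ as $n\to\infty$. Then: (i) $\tilde L_n\to 1$ in probability, and $\dfrac{n}{\log p_n}\,\tilde T_n\to -4$ in probability, as $n\to\infty$. (ii) As $n\to\infty$, the random variable $$n\tilde T_n+\frac{4n}{n-1}\log p_n-\log n$$ converges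 weakly to the probability distribution on $\mathbb R$ with distribution function $F(y)=1-e^{-Ke^{y/2}}$, $y\in\mathbb R$, where $K=1/\sqrt{2\pi}$. -/

import Mathlib

open MeasureTheory ProbabilityTheory Filter Topology

noncomputable section

/-- A random vector `Y` in `ℝⁿ` has a spherical distribution under `μ` if `O Y` and `Y` have the
same law for every orthogonal matrix `O`. -/
def IsSpherical {Ω : Type*} [MeasurableSpace Ω] (μ : Measure Ω) {n : ℕ}
    (Y : Ω → EuclideanSpace ℝ (Fin n)) : Prop :=
  ∀ O ∈ Matrix.orthogonalGroup (Fin n) ℝ,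
    μ.map (fun ω => Matrix.toEuclideanLin O (Y ω)) = μ.map Y

/-- The columns `X 0, …, X (p - 1)` of an `n × p` random matrix are independent random vectors with
a common spherical distribution that has no atom at the origin. -/
structure IndepSphericalColumns {Ω : Type*} [MeasurableSpace Ω] (μ : Measure Ω) {n p : ℕ}
    (X : Fin p → Ω → EuclideanSpace ℝ (Fin n)) : Prop where
  measurable : ∀ i, Measurable (X i)
  indep : iIndepFun X μ
  identDistrib : ∀ i j, IdentDistrib (X i) (X j) μ μ
  spherical : ∀ i, IsSpherical μ (X i)
  ne_zero : ∀ i, μ {ω | X i ω = 0} = 0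

open Classical in
/-- The mean vector of `Y` when it exists; the origin (the centre of symmetry of a spherical
distribution) when it does not. -/
def meanOrZero {Ω : Type*} [MeasurableSpace Ω] (μ : Measure Ω) {n : ℕ}
    (Y : Ω → EuclideanSpace ℝ (Fin n)) : EuclideanSpace ℝ (Fin n) :=
  if Integrable Y μ then ∫ ω, Y ω ∂μ else 0

/-- The correlation coefficient of the random vectors `Y` and `Z` with known means:
`(Y - E Y)ᵀ (Z - E Z) / (‖Y - E Y‖ ‖Z - E Z‖)`. -/
def corrTilde {Ω : Type*} [MeasurableSpace Ω] (μ : Measure Ω) {n : ℕ}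
    (Y Z : Ω → EuclideanSpace ℝ (Fin n)) (ω : Ω) : ℝ :=
  inner ℝ (Y ω - meanOrZero μ Y) (Z ω - meanOrZero μ Z) /
    (‖Y ω - meanOrZero μ Y‖ * ‖Z ω - meanOrZero μ Z‖)

/-- The coherence `max_{i < j} |ρ̃_{ij}|` of the random matrix with columns `X i`. -/
def coherenceTilde {Ω : Type*} [MeasurableSpace Ω] (μ : Measure Ω) {n p : ℕ}
    (X : Fin p → Ω → EuclideanSpace ℝ (Fin n)) (ω : Ω) : ℝ :=
  ⨆ q : {q : Fin p × Fin p // q.1 < q.2}, |corrTilde μ (X q.1.1) (X q.1.2) ω|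

/-- Convergence in probability to a constant `c` of real random variables `Y n`, each defined on its
own probability space. -/
def TendstoInProb {Ω : ℕ → Type*} [∀ n, MeasurableSpace (Ω n)] (μ : ∀ n, Measure (Ω n))
    (Y : ∀ n, Ω n → ℝ) (c : ℝ) : Prop :=
  ∀ ε : ℝ, 0 < ε → Tendsto (fun n => μ n {ω | ε ≤ |Y n ω - c|}) atTop (𝓝 0)

end

/-! The statistic is at most `y` exactly when some pair of columns has absolute cosine at least `t =
√(1 - δ)`, where `δ = tailLevel` solves the equation for `1 - L²`. So the task is a Poisson limit
for the number of such pairs.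

Three facts carry it. First, the cosine between a spherical vector and a fixed direction has a law
that depends neither on the direction nor on the radial law. Hence all pairs have the same
probability `q = capProb`, and two pairs sharing one column are still independent: conditionally on
that column, each has probability `q`. The Chen–Stein bound with neighbourhoods "pairs sharing an
index" then has error at most (number of pairs) · `8 p q ^ 2`, which is of order `1 / p` as soon as
the mean number of pairs converges.

Second, `q` may be computed for the uniform law on the unit ball. Slicing the double cone
perpendicularly to its axis gives `C s ^ k t ≤ q ≤ C s ^ k / t`, with `n = k + 1`, `s = √(1 - t ^
2)`, `C = capConst k`. Since `log p / n → ∞` forces `δ → 0`, that is `t → 1`, these bounds are sharp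
to first order.

Third, log-convexity of Gamma gives `C √n → √(2 / π)`. As `s ^ k` is asymptotic to `√n p⁻² exp (y /
2)` and there are about `p ^ 2 / 2` pairs, the mean tends to `exp (y / 2) / √(2 π)`, which gives
(ii). Part (i) follows from tightness of the statistic in (ii), since dividing by `log p` kills it.
-/

/-! ### Stein's equation and the Chen–Stein bound -/

/-- The Stein solution for the Poisson distribution with parameter `c` and the test set `{0}`. -/
noncomputable def steinFun (c : ℝ) (k : ℕ) : ℝ :=
  ∫ u in (0 : ℝ)..1, u ^ (k - 1) * Real.exp (-(c * u))

lemma steinFun_nonneg (c : ℝ) (k : ℕ) : 0 ≤ steinFun c k :=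
  intervalIntegral.integral_nonneg zero_le_one fun u hu => by
    have := hu.1
    positivity

lemma steinFun_le_one {c : ℝ} (hc : 0 ≤ c) (k : ℕ) : steinFun c k ≤ 1 := by
  have h : steinFun c k ≤ ∫ _u in (0 : ℝ)..1, (1 : ℝ) := by
    refine intervalIntegral.integral_mono_on zero_le_one
      (Continuous.intervalIntegrable (by fun_prop) _ _) (by simp) fun u hu => ?_
    refine mul_le_one₀ (pow_le_one₀ hu.1 hu.2) (Real.exp_nonneg _) ?_
    rw [Real.exp_le_one_iff]
    have := mul_nonneg hc hu.1
    linarith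
  simpa using h

lemma abs_steinFun_sub_le_one {c : ℝ} (hc : 0 ≤ c) (j k : ℕ) :
    |steinFun c j - steinFun c k| ≤ 1 := by
  rw [abs_le]
  constructor <;>
    linarith [steinFun_nonneg c j, steinFun_nonneg c k, steinFun_le_one hc j, steinFun_le_one hc k]

/-- The Stein equation for the Poisson distribution and the test set `{0}`. -/
lemma steinFun_eq (c : ℝ) (k : ℕ) :
    c * steinFun c (k + 1) - k * steinFun c k = (if k = 0 then 1 else 0) - Real.exp (-c) := by
  have hd : ∀ u : ℝ, HasDerivAt (fun u : ℝ => -(u ^ k * Real.exp (-(c * u))))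
      (c * (u ^ k * Real.exp (-(c * u))) - k * (u ^ (k - 1) * Real.exp (-(c * u)))) u := by
    intro u
    have h1 : HasDerivAt (fun u : ℝ => Real.exp (-(c * u))) (Real.exp (-(c * u)) * (-(c * 1))) u :=
      (((hasDerivAt_id u).const_mul c).neg).exp
    refine ((hasDerivAt_pow k u).mul h1).neg.congr_deriv ?_
    ring
  have h := intervalIntegral.integral_eq_sub_of_hasDerivAt (a := 0) (b := 1)
    (fun u _ => hd u) (Continuous.intervalIntegrable (by fun_prop) _ _)
  rw [intervalIntegral.integral_sub (Continuous.intervalIntegrable (by fun_prop) _ _)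
    (Continuous.intervalIntegrable (by fun_prop) _ _), intervalIntegral.integral_const_mul,
    intervalIntegral.integral_const_mul] at h
  simp only [steinFun, Nat.add_sub_cancel]
  rw [h]
  by_cases hk : k = 0
  · simp [hk]
    ring
  · simp [hk]

section ChenStein

variable {Ω ι : Type*} [MeasurableSpace Ω] {μ : Measure Ω} [IsProbabilityMeasure μ]

/-- **Chen–Stein bound** for the probability that no event in a locally dependent finite family
occurs. -/
theorem abs_prob_forall_eq_zero_sub_exp_le [Fintype ι] [DecidableEq ι] {I : ι → Ω → ℕ}
    (hmeas : ∀ a, Measurable (I a)) (hle : ∀ a ω, I a ω ≤ 1) (N : ι → Finset ι)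
    (hN : ∀ a, a ∈ N a)
    (hind : ∀ a, IndepFun (I a) (fun ω => ∑ b ∈ (N a)ᶜ, I b ω) μ) :
    |μ.real {ω | ∀ a, I a ω = 0} - Real.exp (-∑ a, ∫ ω, (I a ω : ℝ) ∂μ)| ≤
      ∑ a, (∑ b ∈ N a, (∫ ω, (I a ω : ℝ) ∂μ) * (∫ ω, (I b ω : ℝ) ∂μ) +
        ∑ b ∈ (N a).erase a, ∫ ω, (I a ω : ℝ) * I b ω ∂μ) := by
  set q : ι → ℝ := fun a => ∫ ω, (I a ω : ℝ) ∂μ with hq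
  set c : ℝ := ∑ a, q a with hc
  have hq0 : ∀ a, 0 ≤ q a := fun a => integral_nonneg fun ω => Nat.cast_nonneg _
  have hc0 : 0 ≤ c := Finset.sum_nonneg fun a _ => hq0 a
  set f := steinFun c with hf
  set W : Ω → ℕ := fun ω => ∑ a, I a ω with hW
  set Z : ι → Ω → ℕ := fun a ω => ∑ b ∈ (N a)ᶜ, I b ω with hZ
  have hWm : Measurable W := Finset.measurable_fun_sum _ fun a _ => hmeas a
  have hZm : ∀ a, Measurable (Z a) := fun a => Finset.measurable_fun_sum _ fun a _ => hmeas a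
  have hfm : Measurable f := measurable_of_countable _
  have hfb : ∀ k, ‖f k‖ ≤ 1 := fun k => by
    rw [Real.norm_of_nonneg (steinFun_nonneg c k)]
    exact steinFun_le_one hc0 k
  have hIb : ∀ a ω, ‖(I a ω : ℝ)‖ ≤ 1 := fun a ω => by
    rw [Real.norm_of_nonneg (Nat.cast_nonneg _)]
    exact_mod_cast hle a ω
  have hIm : ∀ a, Measurable fun ω => (I a ω : ℝ) := fun a =>
    (measurable_of_countable (fun n : ℕ => (n : ℝ))).comp (hmeas a)
  have hII : ∀ a, Integrable (fun ω => (I a ω : ℝ)) μ := fun a =>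
    Integrable.of_bound (hIm a).aestronglyMeasurable 1 (.of_forall (hIb a))
  have hfI : ∀ {g : Ω → ℕ}, Measurable g → Integrable (fun ω => f (g ω)) μ := fun hg =>
    Integrable.of_bound (hfm.comp hg).aestronglyMeasurable 1 (.of_forall fun ω => hfb _)
  have hmulI : ∀ {g h : Ω → ℝ}, Measurable g → Measurable h → (∀ ω, ‖g ω‖ ≤ 1) →
      (∀ ω, ‖h ω‖ ≤ 1) → Integrable (fun ω => g ω * h ω) μ := fun hg hh hg1 hh1 =>
    Integrable.of_bound (hg.mul hh).aestronglyMeasurable 1 (.of_forall fun ω => by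
      rw [norm_mul]
      exact mul_le_one₀ (hg1 ω) (norm_nonneg _) (hh1 ω))
  have hW1 : Measurable fun ω => W ω + 1 := hWm.add_const 1
  have hZ1 : ∀ a, Measurable fun ω => Z a ω + 1 := fun a => (hZm a).add_const 1
  have hsplit : ∀ a ω, W ω = ∑ b ∈ N a, I b ω + Z a ω := fun a ω =>
    (Finset.sum_add_sum_compl (N a) fun b => I b ω).symm
  -- Stein's equation evaluated at `W` and integrated, then split over the events.
  have hmain : μ.real {ω | ∀ a, I a ω = 0} - Real.exp (-c) =
      ∑ a, (q a * ∫ ω, f (W ω + 1) ∂μ - ∫ ω, (I a ω : ℝ) * f (W ω) ∂μ) := by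
    have hset : MeasurableSet {ω | ∀ a, I a ω = 0} := by
      have : {ω | ∀ a, I a ω = 0} = ⋂ a, I a ⁻¹' {0} := by ext; simp
      rw [this]
      exact MeasurableSet.iInter fun a => hmeas a (measurableSet_singleton 0)
    have h1 : μ.real {ω | ∀ a, I a ω = 0} - Real.exp (-c) =
        ∫ ω, (c * f (W ω + 1) - W ω * f (W ω)) ∂μ := by
      have : ∀ ω, c * f (W ω + 1) - W ω * f (W ω) =
          Set.indicator {ω | ∀ a, I a ω = 0} 1 ω - Real.exp (-c) := fun ω => by
        rw [hf, steinFun_eq]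
        congr 1
        simp [Set.indicator_apply, hW]
      simp_rw [this]
      rw [integral_sub (f := Set.indicator {ω | ∀ a, I a ω = 0} 1)
        ((integrable_const (1 : ℝ)).indicator hset) (integrable_const _),
        integral_indicator_one hset]
      simp
    rw [h1]
    have h2 : ∀ ω, c * f (W ω + 1) - W ω * f (W ω) =
        ∑ a, (q a * f (W ω + 1) - (I a ω : ℝ) * f (W ω)) := fun ω => by
      rw [Finset.sum_sub_distrib, ← Finset.sum_mul, ← Finset.sum_mul, hc, hW]
      push_cast
      rfl
    simp_rw [h2]
    rw [integral_finsetSum]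
    · refine Finset.sum_congr rfl fun a _ => ?_
      rw [integral_sub (g := fun ω => (I a ω : ℝ) * f (W ω)) ((hfI hW1).const_mul _)
        (hmulI (hIm a) (hfm.comp hWm) (hIb a) fun ω => hfb _), integral_const_mul]
    · exact fun a _ => ((hfI hW1).const_mul _).sub
        (hmulI (hIm a) (hfm.comp hWm) (hIb a) fun ω => hfb _)
  rw [hmain]
  refine (Finset.abs_sum_le_sum_abs _ _).trans (Finset.sum_le_sum fun a _ => ?_)
  have hindep : ∫ ω, (I a ω : ℝ) * f (Z a ω + 1) ∂μ = q a * ∫ ω, f (Z a ω + 1) ∂μ :=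
    ((hind a).comp (φ := fun n : ℕ => (n : ℝ)) (ψ := fun n => f (n + 1))
      (measurable_of_countable _) (measurable_of_countable _)).integral_fun_mul_eq_mul_integral
      (hIm a).aestronglyMeasurable (hfm.comp (hZ1 a)).aestronglyMeasurable
  -- `W` and `Z a` differ only if an event in `N a` occurs, and then the difference of values of `f`
  -- is at most 1, hence at most the number of such events.
  have hA : |∫ ω, f (W ω + 1) ∂μ - ∫ ω, f (Z a ω + 1) ∂μ| ≤ ∑ b ∈ N a, q b := by
    rw [← integral_sub (hfI hW1) (hfI (hZ1 a))]
    refine (abs_integral_le_integral_abs).trans ?_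
    rw [hq, ← integral_finsetSum _ fun b _ => hII b]
    refine integral_mono ((hfI hW1).sub (hfI (hZ1 a))).abs (integrable_finsetSum _ fun b _ => hII b)
      fun ω => ?_
    rcases Nat.eq_zero_or_pos (∑ b ∈ N a, I b ω) with h | h
    · have : W ω = Z a ω := by rw [hsplit a ω, h, zero_add]
      simp only [this, sub_self, abs_zero]
      exact Finset.sum_nonneg fun b _ => Nat.cast_nonneg _
    · refine (abs_steinFun_sub_le_one hc0 _ _).trans ?_
      exact_mod_cast h
  -- On `I a = 1` one has `W = Z a + 1` unless another neighbour of `a` occurs.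
  have hB : |∫ ω, (I a ω : ℝ) * f (Z a ω + 1) ∂μ - ∫ ω, (I a ω : ℝ) * f (W ω) ∂μ| ≤
      ∑ b ∈ (N a).erase a, ∫ ω, (I a ω : ℝ) * I b ω ∂μ := by
    have i1 := hmulI (hIm a) (hfm.comp (hZ1 a)) (hIb a) fun ω => hfb _
    have i2 := hmulI (hIm a) (hfm.comp hWm) (hIb a) fun ω => hfb _
    have i3 : ∀ b, Integrable (fun ω => (I a ω : ℝ) * I b ω) μ := fun b =>
      hmulI (hIm a) (hIm b) (hIb a) (hIb b)
    have hsub := integral_sub i1 i2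
    simp only [Function.comp_apply] at hsub
    rw [← hsub, ← integral_finsetSum _ fun b _ => i3 b]
    refine (abs_integral_le_integral_abs).trans ?_
    refine integral_mono (i1.sub i2).abs (integrable_finsetSum _ fun b _ => i3 b) fun ω => ?_
    have hsum : ∑ b ∈ N a, I b ω = I a ω + ∑ b ∈ (N a).erase a, I b ω :=
      (Finset.add_sum_erase _ _ (hN a)).symm
    simp only [← Finset.mul_sum, ← mul_sub, abs_mul, Nat.abs_cast]
    rcases Nat.eq_zero_or_pos (I a ω) with h0 | h0
    · simp [h0]
    have h1 : I a ω = 1 := le_antisymm (hle a ω) h0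
    refine mul_le_mul_of_nonneg_left ?_ (Nat.cast_nonneg _)
    rcases Nat.eq_zero_or_pos (∑ b ∈ (N a).erase a, I b ω) with h | h
    · have : W ω = Z a ω + 1 := by rw [hsplit a ω, hsum, h, h1]; ring
      simp only [this, sub_self, abs_zero]
      exact Finset.sum_nonneg fun b _ => Nat.cast_nonneg _
    · refine (abs_steinFun_sub_le_one hc0 _ _).trans ?_
      exact_mod_cast h
  calc |q a * ∫ ω, f (W ω + 1) ∂μ - ∫ ω, (I a ω : ℝ) * f (W ω) ∂μ|
      = |q a * (∫ ω, f (W ω + 1) ∂μ - ∫ ω, f (Z a ω + 1) ∂μ) +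
        (∫ ω, (I a ω : ℝ) * f (Z a ω + 1) ∂μ - ∫ ω, (I a ω : ℝ) * f (W ω) ∂μ)| := by
        rw [hindep]; ring_nf
    _ ≤ q a * ∑ b ∈ N a, q b + ∑ b ∈ (N a).erase a, ∫ ω, (I a ω : ℝ) * I b ω ∂μ := by
        refine (abs_add_le _ _).trans (add_le_add ?_ hB)
        rw [abs_mul, abs_of_nonneg (hq0 a)]
        exact mul_le_mul_of_nonneg_left hA (hq0 a)
    _ = _ := by rw [Finset.mul_sum]

end ChenStein

/-! ### Convergence of distribution functions and the limit law -/

/-- Pointwise convergence of distribution functions implies convergence in distribution. -/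
theorem tendstoInDistribution_of_tendsto_cdf {Ω : ℕ → Type*} [∀ n, MeasurableSpace (Ω n)]
    {μ : ∀ n, Measure (Ω n)} [∀ n, IsProbabilityMeasure (μ n)] {Y : ∀ n, Ω n → ℝ}
    (hY : ∀ n, AEMeasurable (Y n) (μ n)) {ν : Measure ℝ} [IsProbabilityMeasure ν]
    (h : ∀ y, Tendsto (fun n => (μ n).real {ω | Y n ω ≤ y}) atTop (𝓝 (cdf ν y))) :
    TendstoInDistribution Y atTop id μ ν where
  forall_aemeasurable := hY
  aemeasurable_limit := aemeasurable_id
  tendsto := by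
    -- Half-open intervals form a π-system containing small neighbourhoods of every point, so
    -- convergence of their probabilities suffices; those are differences of distribution functions.
    refine (isPiSystem_Ioc (id : ℝ → ℝ) id).tendsto_probabilityMeasure_of_tendsto_of_mem ?_ ?_ ?_
    · rintro _ ⟨a, b, -, rfl⟩
      exact measurableSet_Ioc
    · intro u hu x hx
      obtain ⟨ε, hε, hball⟩ := Metric.isOpen_iff.1 hu x hx
      refine ⟨Set.Ioc (x - ε / 2) (x + ε / 2), ⟨x - ε / 2, x + ε / 2, by simp; linarith, rfl⟩,
        Ioc_mem_nhds (by linarith) (by linarith), fun z hz => hball ?_⟩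
      rw [Metric.mem_ball, Real.dist_eq, abs_lt]
      constructor <;> linarith [hz.1, hz.2]
    · rintro _ ⟨a, b, hab, rfl⟩
      have key : ∀ (ρ : ProbabilityMeasure ℝ),
          ((ρ (Set.Ioc a b) : NNReal) : ℝ) = cdf (ρ : Measure ℝ) b - cdf (ρ : Measure ℝ) a := by
        intro ρ
        rw [cdf_eq_real, cdf_eq_real, ← Set.Iic_sdiff_Iic,
          ← measureReal_sdiff (μ := (ρ : Measure ℝ)) (Set.Iic_subset_Iic.2 (show a ≤ b from hab.le))
            measurableSet_Iic]
        rfl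
      rw [← NNReal.tendsto_coe]
      have hcdf : ∀ y, Tendsto (fun n => cdf ((μ n).map (Y n)) y) atTop
          (𝓝 (cdf (ν.map id) y)) := by
        intro y
        have hpm := fun n => Measure.isProbabilityMeasure_map (hY n)
        simp only [Measure.map_id, cdf_eq_real]
        have := h y
        rw [cdf_eq_real] at this
        refine this.congr fun n => ?_
        rw [map_measureReal_apply_of_aemeasurable (hY n) measurableSet_Iic]
        rfl
      have hpm := fun n => Measure.isProbabilityMeasure_map (hY n)
      have hpm' : IsProbabilityMeasure (ν.map id) := by simpa using ‹IsProbabilityMeasure ν›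
      exact (((hcdf b).sub (hcdf a)).congr fun n => (key ⟨_, hpm n⟩).symm).trans
        (le_of_eq (congrArg 𝓝 (key ⟨_, hpm'⟩).symm))

/-- The probability measure on `ℝ` with distribution function `1 - exp (-K exp (y / 2))`. -/
theorem exists_probabilityMeasure_cdf_eq {K : ℝ} (hK : 0 < K) :
    ∃ (ν : Measure ℝ) (_ : IsProbabilityMeasure ν),
      ∀ y : ℝ, cdf ν y = 1 - Real.exp (-(K * Real.exp (y / 2))) := by
  let F : StieltjesFunction ℝ :=
    { toFun := fun y => 1 - Real.exp (-(K * Real.exp (y / 2)))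
      mono' := fun a b hab => by
        have : Real.exp (a / 2) ≤ Real.exp (b / 2) := Real.exp_le_exp.2 (by linarith)
        have := Real.exp_le_exp.2 (neg_le_neg (mul_le_mul_of_nonneg_left this hK.le))
        simp only
        linarith
      right_continuous' := fun x => by
        have : Continuous fun y : ℝ => 1 - Real.exp (-(K * Real.exp (y / 2))) := by fun_prop
        exact this.continuousWithinAt }
  have hdiv : Tendsto (fun y : ℝ => y / 2) atTop atTop :=
    tendsto_id.atTop_div_const two_pos
  have hdiv' : Tendsto (fun y : ℝ => y / 2) atBot atBot :=
    tendsto_id.atBot_div_const two_pos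
  have h0 : Tendsto F atBot (𝓝 0) := by
    have h1 : Tendsto (fun y : ℝ => Real.exp (y / 2)) atBot (𝓝 0) :=
      Real.tendsto_exp_atBot.comp hdiv'
    have h2 := ((Real.continuous_exp.tendsto _).comp (h1.const_mul K).neg).const_sub 1
    simpa using h2
  have h1 : Tendsto F atTop (𝓝 1) := by
    have h1 : Tendsto (fun y : ℝ => Real.exp (y / 2)) atTop atTop :=
      Real.tendsto_exp_atTop.comp hdiv
    have h2 := (Real.tendsto_exp_neg_atTop_nhds_zero.comp (h1.const_mul_atTop hK)).const_sub 1
    simpa using h2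
  refine ⟨F.measure, ⟨by rw [F.measure_univ h0 h1, sub_zero, ENNReal.ofReal_one]⟩, fun y => ?_⟩
  rw [cdf_measure_stieltjesFunction F h0 h1]

/-! ### Spherical laws and angles -/

section Correlation

variable {E : Type*} [NormedAddCommGroup E] [InnerProductSpace ℝ E]

/-- The cosine of the angle between two vectors. -/
noncomputable def cosAngle (x y : E) : ℝ := inner ℝ x y / (‖x‖ * ‖y‖)

lemma cosAngle_comm (x y : E) : cosAngle x y = cosAngle y x := by
  rw [cosAngle, cosAngle, real_inner_comm, mul_comm]

lemma cosAngle_smul_left {c : ℝ} (hc : 0 < c) (x y : E) : cosAngle (c • x) y = cosAngle x y := by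
  rw [cosAngle, cosAngle, real_inner_smul_left, norm_smul, Real.norm_of_nonneg hc.le, mul_assoc,
    mul_div_mul_left _ _ hc.ne']

lemma cosAngle_map (f : E ≃ₗᵢ[ℝ] E) (x y : E) : cosAngle (f x) (f y) = cosAngle x y := by
  simp [cosAngle]

variable [MeasurableSpace E]

/-- A measure that is invariant under linear isometries and has no atom at the origin. -/
structure IsSphericalLaw (ν : Measure E) : Prop where
  map_eq : ∀ f : E ≃ₗᵢ[ℝ] E, ν.map f = ν
  singleton_zero : ν {0} = 0

lemma IsSphericalLaw.ae_ne_zero {ν : Measure E} (h : IsSphericalLaw ν) : ∀ᵐ x ∂ν, x ≠ 0 := by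
  rw [ae_iff]
  simpa using h.singleton_zero

variable [BorelSpace E] [SecondCountableTopology E]

lemma measurable_cosAngle : Measurable fun p : E × E => cosAngle p.1 p.2 := by
  unfold cosAngle
  fun_prop

lemma measurableSet_le_abs_cosAngle (t : ℝ) (e : E) : MeasurableSet {x | t ≤ |cosAngle e x|} :=
  measurableSet_le measurable_const
    (continuous_abs.measurable.comp (measurable_cosAngle.comp measurable_prodMk_left))

lemma measurableSet_prod_le_abs_cosAngle (t : ℝ) :
    MeasurableSet {p : E × E | t ≤ |cosAngle p.1 p.2|} :=
  measurableSet_le measurable_const (continuous_abs.measurable.comp measurable_cosAngle)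

namespace IsSphericalLaw

variable {ν ν' : Measure E}

/-- After rescaling to equal norms, a reflection carries `e` to `e'`; it preserves both the cosine
and `ν`. -/
lemma measure_le_abs_cosAngle_congr (h : IsSphericalLaw ν) (t : ℝ) {e e' : E} (he : e ≠ 0)
    (he' : e' ≠ 0) : ν {x | t ≤ |cosAngle e x|} = ν {x | t ≤ |cosAngle e' x|} := by
  have hn : 0 < ‖e'‖ / ‖e‖ := div_pos (norm_pos_iff.2 he') (norm_pos_iff.2 he)
  set d : E := (‖e'‖ / ‖e‖) • e with hd
  have hnorm : ‖d‖ = ‖e'‖ := by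
    rw [hd, norm_smul, Real.norm_of_nonneg hn.le, div_mul_cancel₀ _ (norm_ne_zero_iff.2 he)]
  set f := (Submodule.span ℝ {d - e'})ᗮ.reflection
  have hf : f d = e' := Submodule.reflection_sub hnorm
  have h1 : {x | t ≤ |cosAngle e x|} = f ⁻¹' {x | t ≤ |cosAngle e' x|} := by
    ext x
    simp only [Set.mem_ofPred_eq, Set.mem_preimage]
    rw [← hf, cosAngle_map, hd, cosAngle_smul_left hn]
  rw [h1, ← Measure.map_apply f.continuous.measurable (measurableSet_le_abs_cosAngle t e'),
    h.map_eq]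

/-- The integrand is almost everywhere constant. The function `F` is the identity for one pair and
the square for two pairs sharing a vector. -/
lemma lintegral_comp_measure_le_abs_cosAngle [IsProbabilityMeasure ν] (h : IsSphericalLaw ν)
    (h' : IsSphericalLaw ν') (t : ℝ) {e : E} (he : e ≠ 0) (F : ENNReal → ENNReal) :
    ∫⁻ x, F (ν' {y | t ≤ |cosAngle x y|}) ∂ν = F (ν' {y | t ≤ |cosAngle e y|}) := by
  rw [lintegral_congr_ae (g := fun _ => F (ν' {y | t ≤ |cosAngle e y|}))]
  · simp
  · filter_upwards [h.ae_ne_zero] with x hx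
    rw [h'.measure_le_abs_cosAngle_congr t hx he]

lemma prod_le_abs_cosAngle [IsProbabilityMeasure ν] [SFinite ν'] (h : IsSphericalLaw ν)
    (h' : IsSphericalLaw ν') (t : ℝ) {e : E} (he : e ≠ 0) :
    (ν.prod ν') {p | t ≤ |cosAngle p.1 p.2|} = ν' {x | t ≤ |cosAngle e x|} := by
  rw [Measure.prod_apply (measurableSet_prod_le_abs_cosAngle t)]
  exact h.lintegral_comp_measure_le_abs_cosAngle h' t he id

/-- The law of the angle with a fixed direction is the same for all spherical laws. -/
lemma measure_le_abs_cosAngle_eq [IsProbabilityMeasure ν] [IsProbabilityMeasure ν']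
    (h : IsSphericalLaw ν) (h' : IsSphericalLaw ν') (t : ℝ) {e : E} (he : e ≠ 0) :
    ν {x | t ≤ |cosAngle e x|} = ν' {x | t ≤ |cosAngle e x|} := by
  -- Either side is the probability that two independent vectors, one from each law, make such an
  -- angle, and this is symmetric in the two laws.
  rw [← h.prod_le_abs_cosAngle h' t he, ← h'.prod_le_abs_cosAngle h t he,
    ← Measure.prod_swap, Measure.map_apply measurable_swap (measurableSet_prod_le_abs_cosAngle t)]
  congr 1
  ext p
  simp [cosAngle_comm]

/-- Given the first vector, the two events are independent, with a probability not depending on that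
vector. -/
lemma prod_prod_le_abs_cosAngle [IsProbabilityMeasure ν] (h : IsSphericalLaw ν)
    (t : ℝ) {e : E} (he : e ≠ 0) :
    (ν.prod (ν.prod ν)) {p | t ≤ |cosAngle p.1 p.2.1| ∧ t ≤ |cosAngle p.1 p.2.2|} =
      ν {x | t ≤ |cosAngle e x|} ^ 2 := by
  rw [Measure.prod_apply]
  · rw [← h.lintegral_comp_measure_le_abs_cosAngle h t he fun a => a ^ 2]
    refine lintegral_congr fun x => ?_
    rw [sq, ← Measure.prod_prod]
    rfl
  · exact ((measurableSet_prod_le_abs_cosAngle t).preimage (measurable_fst.prodMk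
      measurable_snd.fst)).inter ((measurableSet_prod_le_abs_cosAngle t).preimage
      (measurable_fst.prodMk measurable_snd.snd))

end IsSphericalLaw

end Correlation

section Spherical

variable {Ω : Type*} [MeasurableSpace Ω] {μ : Measure Ω} {n : ℕ}
  {Y : Ω → EuclideanSpace ℝ (Fin n)}

lemma IsSpherical.map_linearIsometryEquiv (h : IsSpherical μ Y)
    (f : EuclideanSpace ℝ (Fin n) ≃ₗᵢ[ℝ] EuclideanSpace ℝ (Fin n)) :
    μ.map (fun ω => f (Y ω)) = μ.map Y := by
  have := h _ (f.toMatrix_mem_unitaryGroup (EuclideanSpace.basisFun _ _)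
    (EuclideanSpace.basisFun _ _))
  rw [Matrix.toEuclideanLin_eq_toLin_orthonormal, Matrix.toLin_toMatrix] at this
  exact this

lemma IsSpherical.isSphericalLaw_map (h : IsSpherical μ Y) (hY : Measurable Y)
    (h0 : μ {ω | Y ω = 0} = 0) : IsSphericalLaw (μ.map Y) where
  map_eq f := by
    rw [Measure.map_map f.continuous.measurable hY]
    exact h.map_linearIsometryEquiv f
  singleton_zero := by
    rw [Measure.map_apply hY (measurableSet_singleton _)]
    exact h0

/-- The law is invariant under `-1`, so an existing mean equals its own negative. -/
lemma IsSpherical.meanOrZero_eq_zero (h : IsSpherical μ Y) (hY : Measurable Y) :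
    meanOrZero μ Y = 0 := by
  unfold meanOrZero
  split_ifs with hi
  · have h1 := h.map_linearIsometryEquiv (LinearIsometryEquiv.neg ℝ)
    have h2 : ∫ x, x ∂(μ.map fun ω => -Y ω) = ∫ x, x ∂(μ.map Y) := by
      rw [← h1]; rfl
    rw [integral_map (φ := fun ω => -Y ω) (f := fun x => x) hY.neg.aemeasurable
        aestronglyMeasurable_id, integral_map (f := fun x => x) hY.aemeasurable
        aestronglyMeasurable_id, integral_neg] at h2
    have h3 := add_eq_zero_iff_eq_neg.2 h2.symm
    rw [← two_smul ℝ] at h3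
    simpa using h3
  · rfl

end Spherical

/-- The reference law: angular probabilities become ratios of volumes. -/
lemma isSphericalLaw_cond_ball {E : Type*} [NormedAddCommGroup E] [InnerProductSpace ℝ E]
    [FiniteDimensional ℝ E] [MeasurableSpace E] [BorelSpace E] [Nontrivial E] :
    IsSphericalLaw ((volume : Measure E)[|Metric.ball 0 1]) where
  map_eq f := by
    ext s hs
    rw [Measure.map_apply f.continuous.measurable hs, cond_apply measurableSet_ball,
      cond_apply measurableSet_ball, ← f.measurePreserving.measure_preimage
      (measurableSet_ball.inter hs).nullMeasurableSet, Set.preimage_inter,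
      LinearIsometryEquiv.preimage_ball]
    simp
  singleton_zero := by
    rw [cond_apply measurableSet_ball]
    simp

/-! ### Volumes of balls and of double cones in the ball -/

/-- The volume of the unit ball of `ℝᵏ`. -/
noncomputable def unitBallVolume (k : ℕ) : ℝ :=
  √Real.pi ^ k / Real.Gamma (k / 2 + 1)

lemma unitBallVolume_pos (k : ℕ) : 0 < unitBallVolume k := by
  have : 0 < Real.Gamma ((k : ℝ) / 2 + 1) := Real.Gamma_pos_of_pos (by positivity)
  unfold unitBallVolume
  have := Real.pi_pos
  positivity

lemma volume_ball_eq_unitBallVolume {k : ℕ} (hk : 1 ≤ k) {r : ℝ} (hr : 0 ≤ r) :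
    volume (Metric.ball (0 : EuclideanSpace ℝ (Fin k)) r) =
      ENNReal.ofReal (unitBallVolume k * r ^ k) := by
  have : Nonempty (Fin k) := ⟨⟨0, hk⟩⟩
  rw [EuclideanSpace.volume_ball, Fintype.card_fin, ← ENNReal.ofReal_pow hr,
    ← ENNReal.ofReal_mul (by positivity), mul_comm]
  rfl

lemma volume_closedBall_eq_unitBallVolume {k : ℕ} (hk : 1 ≤ k) {r : ℝ} (hr : 0 ≤ r) :
    volume (Metric.closedBall (0 : EuclideanSpace ℝ (Fin k)) r) =
      ENNReal.ofReal (unitBallVolume k * r ^ k) := by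
  have : Nonempty (Fin k) := ⟨⟨0, hk⟩⟩
  rw [Measure.addHaar_closedBall_eq_addHaar_ball, volume_ball_eq_unitBallVolume hk hr]

/-- The vector of `ℝᵏ⁺¹` with first coordinate `r` and remaining coordinates `z`. -/
noncomputable def euclideanCons {k : ℕ} (r : ℝ) (z : EuclideanSpace ℝ (Fin k)) :
    EuclideanSpace ℝ (Fin (k + 1)) :=
  WithLp.toLp 2 (Fin.cons r z.ofLp : Fin (k + 1) → ℝ)

@[simp] lemma euclideanCons_zero {k : ℕ} (r : ℝ) (z : EuclideanSpace ℝ (Fin k)) :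
    euclideanCons r z 0 = r := rfl

lemma norm_euclideanCons_sq {k : ℕ} (r : ℝ) (z : EuclideanSpace ℝ (Fin k)) :
    ‖euclideanCons r z‖ ^ 2 = r ^ 2 + ‖z‖ ^ 2 := by
  simp [EuclideanSpace.norm_sq_eq, Fin.sum_univ_succ, euclideanCons]

lemma measurePreserving_euclideanCons (k : ℕ) :
    MeasurePreserving (fun p : ℝ × EuclideanSpace ℝ (Fin k) => euclideanCons p.1 p.2) := by
  have h1 := (PiLp.volume_preserving_toLp (Fin (k + 1))).comp
    (((volume_preserving_piFinSuccAbove (fun _ : Fin (k + 1) => ℝ) 0).symm).comp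
      ((MeasurePreserving.id (volume : Measure ℝ)).prod (PiLp.volume_preserving_ofLp (Fin k))))
  have heq : (fun p : ℝ × EuclideanSpace ℝ (Fin k) => euclideanCons p.1 p.2) =
      WithLp.toLp 2 ∘ (MeasurableEquiv.piFinSuccAbove (fun _ => ℝ) 0).symm ∘
        Prod.map id WithLp.ofLp := by
    ext p i
    refine Fin.cases ?_ (fun j => ?_) i <;> rfl
  rw [heq]
  exact h1

lemma volume_eq_lintegral_slice {k : ℕ} {A : Set (EuclideanSpace ℝ (Fin (k + 1)))}
    (hA : MeasurableSet A) :
    volume A = ∫⁻ r : ℝ, volume {z : EuclideanSpace ℝ (Fin k) | euclideanCons r z ∈ A} := by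
  rw [← (measurePreserving_euclideanCons k).measure_preimage hA.nullMeasurableSet,
    Measure.volume_eq_prod,
    Measure.prod_apply ((measurePreserving_euclideanCons k).measurable hA)]
  rfl

lemma integrable_comp_abs {h : ℝ → ℝ} (hh : Integrable h) : Integrable fun r => h |r| := by
  have h1 : IntegrableOn (fun r => h |r|) (Set.Ioi 0) :=
    hh.integrableOn.congr_fun (fun x hx => by simp only [abs_of_pos (Set.mem_Ioi.1 hx)])
      measurableSet_Ioi
  have h2 : IntegrableOn (fun r => h |r|) (Set.Iic 0) :=
    hh.comp_neg.integrableOn.congr_fun (fun x hx => by simp only [abs_of_nonpos (Set.mem_Iic.1 hx)])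
      measurableSet_Iic
  rw [← integrableOn_univ, ← Set.Iic_union_Ioi (a := (0 : ℝ))]
  exact h2.union h1

/-- The part of the open unit ball at angular distance at most `arccos t` from the first axis. -/
def ballCap (k : ℕ) (t : ℝ) : Set (EuclideanSpace ℝ (Fin (k + 1))) :=
  Metric.ball 0 1 ∩ {x | t ≤ |cosAngle (EuclideanSpace.single 0 1) x|}

lemma measurableSet_ballCap (k : ℕ) (t : ℝ) : MeasurableSet (ballCap k t) :=
  measurableSet_ball.inter (measurableSet_le_abs_cosAngle _ _)

lemma abs_cosAngle_single {k : ℕ} (x : EuclideanSpace ℝ (Fin (k + 1))) :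
    |cosAngle (EuclideanSpace.single 0 1) x| = |x 0| / ‖x‖ := by
  simp [cosAngle, abs_div, EuclideanSpace.inner_single_left]

lemma euclideanCons_mem_ballCap_iff {k : ℕ} {t r : ℝ} (ht : 0 < t)
    (z : EuclideanSpace ℝ (Fin k)) :
    euclideanCons r z ∈ ballCap k t ↔
      r ≠ 0 ∧ r ^ 2 + ‖z‖ ^ 2 < 1 ∧ t ^ 2 * (r ^ 2 + ‖z‖ ^ 2) ≤ r ^ 2 := by
  have hball : euclideanCons r z ∈ Metric.ball 0 1 ↔ r ^ 2 + ‖z‖ ^ 2 < 1 := by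
    rw [mem_ball_zero_iff, ← norm_euclideanCons_sq, sq_lt_one_iff₀ (norm_nonneg _)]
  rw [ballCap, Set.mem_inter_iff, hball, Set.mem_ofPred_eq, abs_cosAngle_single,
    euclideanCons_zero]
  -- When the first coordinate vanishes the cosine is 0, also at the origin by division by zero, so
  -- `0 < t` excludes the vector.
  by_cases hr : r = 0
  · simp [hr, ht]
  · have hpos : 0 < ‖euclideanCons r z‖ := by
      rw [norm_pos_iff]
      rintro h
      exact hr (by rw [← euclideanCons_zero r z, h]; rfl)
    rw [le_div_iff₀ hpos, ← norm_euclideanCons_sq, ← mul_pow, ← sq_abs r,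
      pow_le_pow_iff_left₀ (by positivity) (by positivity) two_ne_zero]
    simp [hr]

/-- Only slices at height `|r| < t` are kept. There the cone section, of radius `s / t * |r|`, lies
entirely in the unit ball. -/
lemma volume_ballCap_ge {k : ℕ} (hk : 1 ≤ k) {t : ℝ} (ht : 0 < t) (ht1 : t ≤ 1) :
    ENNReal.ofReal (2 * unitBallVolume k * √(1 - t ^ 2) ^ k * t / (k + 1)) ≤
      volume (ballCap k t) := by
  set s := √(1 - t ^ 2) with hs
  have hs0 : 0 ≤ s := Real.sqrt_nonneg _
  have hs2 : s ^ 2 = 1 - t ^ 2 := Real.sq_sqrt (by nlinarith)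
  have hV := unitBallVolume_pos k
  set h : ℝ → ℝ := (Set.Ioo 0 t).indicator fun r => unitBallVolume k * (s / t * r) ^ k with hh
  have hint : ∫ r : ℝ, h |r| = 2 * unitBallVolume k * s ^ k * t / (k + 1) := by
    rw [integral_comp_abs, hh, setIntegral_indicator measurableSet_Ioo,
      Set.inter_eq_self_of_subset_right (fun x hx => hx.1), ← integral_Ioc_eq_integral_Ioo,
      ← intervalIntegral.integral_of_le ht.le]
    simp only [mul_pow, div_pow, intervalIntegral.integral_const_mul, integral_pow]
    field_simp
    ring
  have hnn : ∀ r, 0 ≤ h r := fun r => Set.indicator_nonneg (fun x hx => by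
    have := hx.1
    positivity) r
  have hI : Integrable fun r : ℝ => h |r| := by
    refine integrable_comp_abs (IntegrableOn.integrable_indicator ?_ measurableSet_Ioo)
    exact (Continuous.integrableOn_Icc (by fun_prop)).mono_set Set.Ioo_subset_Icc_self
  rw [← hint, ofReal_integral_eq_lintegral_ofReal hI (.of_forall fun r => hnn _),
    volume_eq_lintegral_slice (measurableSet_ballCap k t)]
  refine lintegral_mono fun r => ?_
  by_cases hr : |r| ∈ Set.Ioo 0 t
  · simp only [hh, Set.indicator_of_mem hr]
    have h0 : 0 ≤ s / t * |r| := by positivity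
    rw [← volume_ball_eq_unitBallVolume hk h0]
    refine measure_mono fun z hz => ?_
    rw [mem_ball_zero_iff] at hz
    have hz2 : t ^ 2 * ‖z‖ ^ 2 ≤ (1 - t ^ 2) * r ^ 2 := by
      have : ‖z‖ ^ 2 ≤ (s / t * |r|) ^ 2 := pow_le_pow_left₀ (norm_nonneg _) hz.le 2
      rw [mul_pow, div_pow, sq_abs, hs2, div_mul_eq_mul_div, le_div_iff₀ (by positivity)] at this
      linarith
    have hrt : r ^ 2 < t ^ 2 := by
      rw [← sq_abs r]
      exact pow_lt_pow_left₀ hr.2 (abs_nonneg _) two_ne_zero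
    refine (euclideanCons_mem_ballCap_iff ht z).2 ⟨abs_pos.1 hr.1, ?_, by linarith⟩
    have : t ^ 2 * (r ^ 2 + ‖z‖ ^ 2) < t ^ 2 * 1 := by linarith
    exact lt_of_mul_lt_mul_left this (by positivity)
  · simp [hh, Set.indicator_of_notMem hr]

lemma integral_mul_sqrt_one_sub_sq_pow (k : ℕ) {t : ℝ} (ht : 0 < t) (ht1 : t ≤ 1) :
    ∫ r in t..1, r * √(1 - r ^ 2) ^ k = √(1 - t ^ 2) ^ (k + 2) / (k + 2) := by
  have hk : (k : ℝ) + 2 ≠ 0 := by positivity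
  rw [intervalIntegral.integral_eq_sub_of_hasDerivAt_of_le
    (f := fun r => -(√(1 - r ^ 2) ^ (k + 2) / (k + 2))) ht1
    (Continuous.continuousOn (by fun_prop)) ?_ (Continuous.intervalIntegrable (by fun_prop) _ _)]
  · simp
  · intro r hr
    have h1 : 0 < 1 - r ^ 2 := by nlinarith [hr.1, hr.2]
    have hd : HasDerivAt (fun r : ℝ => 1 - r ^ 2) (-(2 * r)) r := by
      simpa using (hasDerivAt_pow 2 r).const_sub 1
    refine (((hd.sqrt h1.ne').pow (k + 2)).div_const _).neg.congr_deriv ?_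
    have := (Real.sqrt_pos.2 h1).ne'
    push_cast
    field_simp
    rw [pow_succ]
    ring

/-- Slices up to height `t` are bounded by the cone section, higher ones by the section of the ball.
In the latter a factor `|r| / t ≥ 1` is inserted to make the integral elementary. -/
lemma volume_ballCap_le {k : ℕ} (hk : 1 ≤ k) {t : ℝ} (ht : 0 < t) (ht1 : t ≤ 1) :
    volume (ballCap k t) ≤
      ENNReal.ofReal (2 * unitBallVolume k * √(1 - t ^ 2) ^ k / (t * (k + 1))) := by
  set s := √(1 - t ^ 2) with hs
  have hs0 : 0 ≤ s := Real.sqrt_nonneg _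
  have hs2 : s ^ 2 = 1 - t ^ 2 := Real.sq_sqrt (by nlinarith)
  have hV := unitBallVolume_pos k
  set h₁ : ℝ → ℝ := (Set.Ioc 0 t).indicator fun r => (s / t * r) ^ k with hh₁
  set h₂ : ℝ → ℝ := (Set.Ioc t 1).indicator fun r => r * √(1 - r ^ 2) ^ k / t with hh₂
  set h : ℝ → ℝ := fun r => unitBallVolume k * (h₁ r + h₂ r) with hh
  have hI₁ : Integrable h₁ := IntegrableOn.integrable_indicator
    ((Continuous.integrableOn_Icc (by fun_prop)).mono_set Set.Ioc_subset_Icc_self) measurableSet_Ioc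
  have hI₂ : Integrable h₂ := IntegrableOn.integrable_indicator
    ((Continuous.integrableOn_Icc (by fun_prop)).mono_set Set.Ioc_subset_Icc_self) measurableSet_Ioc
  have hint : ∫ r : ℝ, h |r| ≤ 2 * unitBallVolume k * s ^ k / (t * (k + 1)) := by
    have e₁ : ∫ r in Set.Ioi 0, h₁ r = s ^ k * t / (k + 1) := by
      rw [hh₁, setIntegral_indicator measurableSet_Ioc,
        Set.inter_eq_self_of_subset_right (fun x hx => hx.1),
        ← intervalIntegral.integral_of_le ht.le]
      simp only [mul_pow, div_pow, intervalIntegral.integral_const_mul, integral_pow]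
      field_simp
      ring
    have e₂ : ∫ r in Set.Ioi 0, h₂ r = s ^ (k + 2) / (k + 2) / t := by
      rw [hh₂, setIntegral_indicator measurableSet_Ioc,
        Set.inter_eq_self_of_subset_right
          (show Set.Ioc t 1 ⊆ Set.Ioi 0 from fun x hx => ht.trans hx.1),
        ← intervalIntegral.integral_of_le ht1, intervalIntegral.integral_div,
        integral_mul_sqrt_one_sub_sq_pow k ht ht1]
    rw [integral_comp_abs, hh, integral_const_mul,
      integral_add hI₁.integrableOn hI₂.integrableOn, e₁, e₂]
    -- Weakening `k + 2` to `k + 1` lets the two parts combine through `s ^ 2 + t ^ 2 = 1`.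
    have h3 : s ^ (k + 2) / (k + 2) / t ≤ s ^ (k + 2) / (k + 1) / t := by
      gcongr; norm_num
    have h4 : s ^ k * t / (k + 1) + s ^ (k + 2) / (k + 1) / t = s ^ k / (t * (k + 1)) := by
      rw [pow_add, hs2]
      field_simp
      ring
    calc 2 * (unitBallVolume k * (s ^ k * t / (k + 1) + s ^ (k + 2) / (k + 2) / t))
        ≤ 2 * (unitBallVolume k * (s ^ k / (t * (k + 1)))) := by
          rw [← h4]; gcongr
      _ = _ := by ring
  have hnn : ∀ r, 0 ≤ h r := fun r => by
    have a₁ : 0 ≤ h₁ r := Set.indicator_nonneg (fun x hx => by have := hx.1; positivity) r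
    have a₂ : 0 ≤ h₂ r := Set.indicator_nonneg (fun x hx => by
      have := ht.trans hx.1; positivity) r
    positivity
  have hI : Integrable fun r : ℝ => h |r| :=
    integrable_comp_abs ((hI₁.add hI₂).const_mul _)
  refine le_trans ?_ (ENNReal.ofReal_le_ofReal hint)
  rw [ofReal_integral_eq_lintegral_ofReal hI (.of_forall fun r => hnn _),
    volume_eq_lintegral_slice (measurableSet_ballCap k t)]
  refine lintegral_mono fun r => ?_
  simp only [euclideanCons_mem_ballCap_iff ht]
  by_cases hr0 : r = 0
  · simp [hr0]
  have hr0' : 0 < |r| := abs_pos.2 hr0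
  rcases le_or_gt |r| t with hrt | hrt
  · have hm : h |r| = unitBallVolume k * (s / t * |r|) ^ k := by
      have hmem : |r| ∈ Set.Ioc 0 t := ⟨hr0', hrt⟩
      simp only [hh, hh₁, hh₂]
      rw [Set.indicator_of_mem hmem,
        Set.indicator_of_notMem fun h : |r| ∈ Set.Ioc t 1 => hrt.not_gt h.1,
        add_zero]
    have h0 : 0 ≤ s / t * |r| := by positivity
    rw [hm, ← volume_closedBall_eq_unitBallVolume hk h0]
    refine measure_mono fun z hz => ?_
    rw [mem_closedBall_zero_iff]
    refine (pow_le_pow_iff_left₀ (norm_nonneg _) h0 two_ne_zero).1 ?_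
    rw [mul_pow, div_pow, sq_abs, hs2, div_mul_eq_mul_div, le_div_iff₀ (by positivity)]
    linarith [hz.2.2]
  rcases le_or_gt |r| 1 with hr1 | hr1
  · have hm : h |r| = unitBallVolume k * (|r| * √(1 - |r| ^ 2) ^ k / t) := by
      have hmem : |r| ∈ Set.Ioc t 1 := ⟨hrt, hr1⟩
      simp only [hh, hh₁, hh₂]
      rw [Set.indicator_of_mem hmem,
        Set.indicator_of_notMem fun h : |r| ∈ Set.Ioc 0 t => hrt.not_ge h.2, zero_add]
    have hsub : {z : EuclideanSpace ℝ (Fin k) | r ≠ 0 ∧ r ^ 2 + ‖z‖ ^ 2 < 1 ∧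
        t ^ 2 * (r ^ 2 + ‖z‖ ^ 2) ≤ r ^ 2} ⊆ Metric.closedBall 0 √(1 - |r| ^ 2) := fun z hz => by
      rw [mem_closedBall_zero_iff]
      refine Real.le_sqrt_of_sq_le ?_
      rw [sq_abs]
      linarith [hz.2.1]
    refine (measure_mono hsub).trans ?_
    rw [hm, volume_closedBall_eq_unitBallVolume hk (Real.sqrt_nonneg _)]
    refine ENNReal.ofReal_le_ofReal (mul_le_mul_of_nonneg_left ?_ hV.le)
    rw [mul_div_right_comm]
    exact le_mul_of_one_le_left (by positivity) ((one_le_div ht).2 hrt.le)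
  · have hempty : {z : EuclideanSpace ℝ (Fin k) | r ≠ 0 ∧ r ^ 2 + ‖z‖ ^ 2 < 1 ∧
        t ^ 2 * (r ^ 2 + ‖z‖ ^ 2) ≤ r ^ 2} = ∅ := by
      refine Set.eq_empty_of_forall_notMem fun z hz => ?_
      have := hz.2.1
      rw [← sq_abs r] at this
      nlinarith [sq_nonneg ‖z‖]
    rw [hempty]
    simp

/-! ### The cap probability -/

/-- The probability that the angle between the first axis and a spherically distributed vector of
`ℝᵏ⁺¹` has cosine at least `t` in absolute value. -/
noncomputable def capProb (k : ℕ) (t : ℝ) : ℝ :=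
  ((volume : Measure (EuclideanSpace ℝ (Fin (k + 1))))[|Metric.ball 0 1]).real
    {x | t ≤ |cosAngle (EuclideanSpace.single 0 1) x|}

/-- The normalizing constant of the law of the cosine of a random angle in `ℝᵏ⁺¹`. -/
noncomputable def capConst (k : ℕ) : ℝ :=
  2 * unitBallVolume k / ((k + 1) * unitBallVolume (k + 1))

lemma capProb_eq (k : ℕ) (t : ℝ) :
    capProb k t = (unitBallVolume (k + 1))⁻¹ * (volume (ballCap k t)).toReal := by
  have h := volume_ball_eq_unitBallVolume (k := k + 1) (by omega) zero_le_one
  rw [capProb, Measure.real, cond_apply measurableSet_ball, ENNReal.toReal_mul,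
    ENNReal.toReal_inv, h, one_pow, mul_one, ENNReal.toReal_ofReal (unitBallVolume_pos _).le]
  rfl

lemma capProb_ge {k : ℕ} (hk : 1 ≤ k) {t : ℝ} (ht : 0 < t) (ht1 : t ≤ 1) :
    capConst k * √(1 - t ^ 2) ^ k * t ≤ capProb k t := by
  have hV := unitBallVolume_pos k
  have hV' := unitBallVolume_pos (k + 1)
  have hfin : volume (ballCap k t) ≠ ⊤ :=
    ((measure_mono Set.inter_subset_left).trans_lt measure_ball_lt_top).ne
  have h := (ENNReal.ofReal_le_iff_le_toReal hfin).1 (volume_ballCap_ge hk ht ht1)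
  rw [capProb_eq, capConst]
  refine le_trans (le_of_eq ?_) (mul_le_mul_of_nonneg_left h (inv_nonneg.2 hV'.le))
  field_simp

lemma capProb_le {k : ℕ} (hk : 1 ≤ k) {t : ℝ} (ht : 0 < t) (ht1 : t ≤ 1) :
    capProb k t ≤ capConst k * √(1 - t ^ 2) ^ k / t := by
  have hV := unitBallVolume_pos k
  have hV' := unitBallVolume_pos (k + 1)
  have h := ENNReal.toReal_mono ENNReal.ofReal_ne_top (volume_ballCap_le hk ht ht1)
  rw [ENNReal.toReal_ofReal (by positivity)] at h
  rw [capProb_eq, capConst]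
  refine (mul_le_mul_of_nonneg_left h (inv_nonneg.2 hV'.le)).trans (le_of_eq ?_)
  field_simp

lemma IsSphericalLaw.measureReal_le_abs_cosAngle {k : ℕ}
    {ν : Measure (EuclideanSpace ℝ (Fin (k + 1)))} [IsProbabilityMeasure ν]
    (h : IsSphericalLaw ν) (t : ℝ) :
    ν.real {x | t ≤ |cosAngle (EuclideanSpace.single 0 1) x|} = capProb k t := by
  have : IsProbabilityMeasure
      ((volume : Measure (EuclideanSpace ℝ (Fin (k + 1))))[|Metric.ball 0 1]) :=
    cond_isProbabilityMeasure_of_finite (Metric.measure_ball_pos _ _ one_pos).ne'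
      measure_ball_lt_top.ne
  rw [capProb, Measure.real, h.measure_le_abs_cosAngle_eq isSphericalLaw_cond_ball t (by simp)]
  rfl

/-! ### Angles between independent columns -/

namespace IndepSphericalColumns

variable {Ω : Type*} [MeasurableSpace Ω] {μ : Measure Ω} {n p : ℕ}

lemma isSphericalLaw {X : Fin p → Ω → EuclideanSpace ℝ (Fin n)} (hX : IndepSphericalColumns μ X)
    (i : Fin p) : IsSphericalLaw (μ.map (X i)) :=
  (hX.spherical i).isSphericalLaw_map (hX.measurable i) (hX.ne_zero i)

lemma corrTilde_eq {X : Fin p → Ω → EuclideanSpace ℝ (Fin n)} (hX : IndepSphericalColumns μ X)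
    (i j : Fin p) (ω : Ω) : corrTilde μ (X i) (X j) ω = cosAngle (X i ω) (X j ω) := by
  simp [corrTilde, cosAngle, (hX.spherical _).meanOrZero_eq_zero (hX.measurable _)]

lemma measurableSet_le_abs_cosAngle {X : Fin p → Ω → EuclideanSpace ℝ (Fin n)}
    (hX : IndepSphericalColumns μ X) (t : ℝ) (i j : Fin p) :
    MeasurableSet {ω | t ≤ |cosAngle (X i ω) (X j ω)|} :=
  (measurableSet_prod_le_abs_cosAngle t).preimage ((hX.measurable i).prodMk (hX.measurable j))

lemma indepFun_sum_of_disjoint {X : Fin p → Ω → EuclideanSpace ℝ (Fin n)}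
    (hX : IndepSphericalColumns μ X)
    {J : EuclideanSpace ℝ (Fin n) × EuclideanSpace ℝ (Fin n) → ℕ} (hJ : Measurable J)
    (i j : Fin p) (M : Finset {q : Fin p × Fin p // q.1 < q.2})
    (hM : ∀ b ∈ M, b.1.1 ∉ ({i, j} : Finset (Fin p)) ∧ b.1.2 ∉ ({i, j} : Finset (Fin p))) :
    IndepFun (fun ω => J (X i ω, X j ω)) (fun ω => ∑ b ∈ M, J (X b.1.1 ω, X b.1.2 ω)) μ := by
  set S : Finset (Fin p) := {i, j} with hS
  have hi : i ∈ S := by simp [hS]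
  have hj : j ∈ S := by simp [hS]
  -- Extension by zero expresses the sum over `M` as a function of the columns outside `S` alone;
  -- the value 0 is never used for pairs in `M`.
  let extendZero : (↥(Sᶜ : Finset (Fin p)) → EuclideanSpace ℝ (Fin n)) → Fin p →
      EuclideanSpace ℝ (Fin n) := fun g l => if h : l ∈ Sᶜ then g ⟨l, h⟩ else 0
  have hextend : ∀ l, Measurable fun g => extendZero g l := fun l => by
    by_cases h : l ∈ Sᶜ
    · simp only [extendZero, h, dif_pos]
      exact measurable_pi_apply _
    · simp only [extendZero, h, dif_neg, not_false_eq_true]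
      exact measurable_const
  have hφ : Measurable fun g : S → EuclideanSpace ℝ (Fin n) => J (g ⟨i, hi⟩, g ⟨j, hj⟩) :=
    hJ.comp ((measurable_pi_apply _).prodMk (measurable_pi_apply _))
  have hψ : Measurable fun g : ↥(Sᶜ : Finset (Fin p)) → EuclideanSpace ℝ (Fin n) =>
      ∑ b ∈ M, J (extendZero g b.1.1, extendZero g b.1.2) :=
    Finset.measurable_fun_sum _ fun b _ => hJ.comp ((hextend _).prodMk (hextend _))
  have h := (hX.indep.indepFun_finset S Sᶜ disjoint_compl_right hX.measurable).comp hφ hψ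
  refine h.congr (.of_forall fun ω => rfl) (.of_forall fun ω => ?_)
  refine Finset.sum_congr rfl fun b hb => ?_
  have h1 : b.1.1 ∈ Sᶜ := Finset.mem_compl.2 (hM b hb).1
  have h2 : b.1.2 ∈ Sᶜ := Finset.mem_compl.2 (hM b hb).2
  simp only [extendZero, h1, h2, dif_pos]

variable {k : ℕ} [IsProbabilityMeasure μ] {X : Fin p → Ω → EuclideanSpace ℝ (Fin (k + 1))}

lemma prob_le_abs_cosAngle (hX : IndepSphericalColumns μ X) (t : ℝ) {i j : Fin p} (hij : i ≠ j) :
    μ.real {ω | t ≤ |cosAngle (X i ω) (X j ω)|} = capProb k t := by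
  have hpm := fun i => Measure.isProbabilityMeasure_map (hX.measurable i).aemeasurable (μ := μ)
  have h1 := (indepFun_iff_map_prod_eq_prod_map_map (hX.measurable i).aemeasurable
    (hX.measurable j).aemeasurable).1 (hX.indep.indepFun hij)
  rw [← (hX.isSphericalLaw j).measureReal_le_abs_cosAngle t, Measure.real, Measure.real,
    ← (hX.isSphericalLaw i).prod_le_abs_cosAngle (hX.isSphericalLaw j) t (by simp), ← h1,
    Measure.map_apply ((hX.measurable i).prodMk (hX.measurable j))
      (measurableSet_prod_le_abs_cosAngle t)]
  rfl

lemma prob_le_abs_cosAngle_and (hX : IndepSphericalColumns μ X) (t : ℝ) {i j l : Fin p}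
    (hij : i ≠ j) (hil : i ≠ l) (hjl : j ≠ l) :
    μ.real ({ω | t ≤ |cosAngle (X i ω) (X j ω)|} ∩ {ω | t ≤ |cosAngle (X i ω) (X l ω)|}) =
      capProb k t ^ 2 := by
  have hpm := fun i => Measure.isProbabilityMeasure_map (hX.measurable i).aemeasurable (μ := μ)
  have hm := hX.measurable
  have h1 := (indepFun_iff_map_prod_eq_prod_map_map (hm i).aemeasurable
    ((hm j).prodMk (hm l)).aemeasurable).1
    (hX.indep.indepFun_prodMk hX.measurable j l i hij.symm hil.symm).symm
  have h2 := (indepFun_iff_map_prod_eq_prod_map_map (hm j).aemeasurable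
    (hm l).aemeasurable).1 (hX.indep.indepFun hjl)
  rw [h2, (hX.identDistrib j i).map_eq, (hX.identDistrib l i).map_eq] at h1
  have h3 := (hX.isSphericalLaw i).prod_prod_le_abs_cosAngle t
    (e := EuclideanSpace.single 0 1) (by simp)
  rw [← h1, Measure.map_apply ((hm i).prodMk ((hm j).prodMk (hm l)))] at h3
  · rw [← (hX.isSphericalLaw i).measureReal_le_abs_cosAngle t, Measure.real, Measure.real,
      ← ENNReal.toReal_pow, ← h3]
    rfl
  · exact ((measurableSet_prod_le_abs_cosAngle t).preimage (measurable_fst.prodMk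
      measurable_snd.fst)).inter ((measurableSet_prod_le_abs_cosAngle t).preimage
      (measurable_fst.prodMk measurable_snd.snd))

end IndepSphericalColumns

/-! ### Counting pairs and Poisson approximation -/

lemma card_pairs_mul_two (p : ℕ) :
    Fintype.card {q : Fin p × Fin p // q.1 < q.2} * 2 = p * (p - 1) := by
  rw [Fintype.card_subtype, Finset.card_filter, ← Finset.univ_product_univ,
    Finset.sum_product_right, ← Finset.sum_range_id_mul_two, ← Fin.sum_univ_eq_sum_range]
  congr 1
  refine Finset.sum_congr rfl fun j _ => ?_
  rw [← Finset.card_filter]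
  rw [Finset.filter_gt_eq_Iio, Fin.card_Iio]

/-- The pairs that share an index with a given pair. -/
def adjacentPairs {p : ℕ} (a : {q : Fin p × Fin p // q.1 < q.2}) :
    Finset {q : Fin p × Fin p // q.1 < q.2} :=
  Finset.univ.filter fun b =>
    b.1.1 = a.1.1 ∨ b.1.1 = a.1.2 ∨ b.1.2 = a.1.1 ∨ b.1.2 = a.1.2

/-- There are four ways to share an index, and each leaves at most `p` choices for the other one. -/
lemma card_adjacentPairs_le {p : ℕ} (a : {q : Fin p × Fin p // q.1 < q.2}) :
    (adjacentPairs a).card ≤ 4 * p := by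
  have h1 : ∀ x : Fin p, (Finset.univ.filter
      fun b : {q : Fin p × Fin p // q.1 < q.2} => b.1.1 = x).card ≤ p := fun x => by
    refine (Finset.card_le_card_of_injOn (t := Finset.univ) (fun b => b.1.2) (by simp) ?_).trans
      (by simp)
    rintro ⟨⟨b, b'⟩, _⟩ hb ⟨⟨c, c'⟩, _⟩ hc h
    simp_all
  have h2 : ∀ x : Fin p, (Finset.univ.filter
      fun b : {q : Fin p × Fin p // q.1 < q.2} => b.1.2 = x).card ≤ p := fun x => by
    refine (Finset.card_le_card_of_injOn (t := Finset.univ) (fun b => b.1.1) (by simp) ?_).trans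
      (by simp)
    rintro ⟨⟨b, b'⟩, _⟩ hb ⟨⟨c, c'⟩, _⟩ hc h
    simp_all
  rw [adjacentPairs, Finset.filter_or, Finset.filter_or, Finset.filter_or]
  have := h1 a.1.1
  have := h1 a.1.2
  have := h2 a.1.1
  have := h2 a.1.2
  refine (Finset.card_union_le _ _).trans ?_
  have e1 := Finset.card_union_le
    (Finset.univ.filter fun b : {q : Fin p × Fin p // q.1 < q.2} => b.1.1 = a.1.2)
    ((Finset.univ.filter fun b : {q : Fin p × Fin p // q.1 < q.2} => b.1.2 = a.1.1) ∪
      Finset.univ.filter fun b : {q : Fin p × Fin p // q.1 < q.2} => b.1.2 = a.1.2)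
  have e2 := Finset.card_union_le
    (Finset.univ.filter fun b : {q : Fin p × Fin p // q.1 < q.2} => b.1.2 = a.1.1)
    (Finset.univ.filter fun b : {q : Fin p × Fin p // q.1 < q.2} => b.1.2 = a.1.2)
  omega

/-- Poisson approximation of the probability that all angles have cosine less than `t` in absolute
value. -/
theorem IndepSphericalColumns.abs_prob_forall_abs_cosAngle_lt_sub_exp_le {Ω : Type*}
    [MeasurableSpace Ω] {μ : Measure Ω} [IsProbabilityMeasure μ] {p k : ℕ}
    {X : Fin p → Ω → EuclideanSpace ℝ (Fin (k + 1))} (hX : IndepSphericalColumns μ X) (t : ℝ) :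
    |μ.real {ω | ∀ a : {q : Fin p × Fin p // q.1 < q.2},
        |cosAngle (X a.1.1 ω) (X a.1.2 ω)| < t} -
      Real.exp (-(Fintype.card {q : Fin p × Fin p // q.1 < q.2} * capProb k t))| ≤
    Fintype.card {q : Fin p × Fin p // q.1 < q.2} * (8 * p * capProb k t ^ 2) := by
  classical
  set J : EuclideanSpace ℝ (Fin (k + 1)) × EuclideanSpace ℝ (Fin (k + 1)) → ℕ :=
    {z | t ≤ |cosAngle z.1 z.2|}.indicator 1 with hJdef
  have hJ : Measurable J := measurable_one.indicator (measurableSet_prod_le_abs_cosAngle t)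
  have hJcast : ∀ (i j : Fin p) ω, (J (X i ω, X j ω) : ℝ) =
      {ω | t ≤ |cosAngle (X i ω) (X j ω)|}.indicator 1 ω := fun i j ω => by
    simp [hJdef, Set.indicator_apply]
  have hJsymm : ∀ x y, J (x, y) = J (y, x) := fun x y => by
    simp [hJdef, Set.indicator_apply, cosAngle_comm x y]
  set I : {q : Fin p × Fin p // q.1 < q.2} → Ω → ℕ := fun a ω => J (X a.1.1 ω, X a.1.2 ω) with hI
  have h1 : ∀ a, ∫ ω, (I a ω : ℝ) ∂μ = capProb k t := fun a => by
    simp only [hI, hJcast]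
    rw [integral_indicator_one (hX.measurableSet_le_abs_cosAngle t _ _),
      hX.prob_le_abs_cosAngle t a.2.ne]
  have h2 : ∀ {i j l : Fin p}, i ≠ j → i ≠ l → j ≠ l →
      ∫ ω, (J (X i ω, X j ω) : ℝ) * J (X i ω, X l ω) ∂μ = capProb k t ^ 2 := by
    intro i j l hij hil hjl
    simp only [hJcast]
    rw [← hX.prob_le_abs_cosAngle_and t hij hil hjl, ← integral_indicator_one
      ((hX.measurableSet_le_abs_cosAngle t _ _).inter (hX.measurableSet_le_abs_cosAngle t _ _))]
    simp only [Set.inter_indicator_one, Pi.mul_apply]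
  -- In each of the four ways of sharing an index, symmetry of `J` brings the shared column to the
  -- front.
  have h3 : ∀ a, ∀ b ∈ (adjacentPairs a).erase a, ∫ ω, (I a ω : ℝ) * I b ω ∂μ =
      capProb k t ^ 2 := by
    rintro ⟨⟨a₁, a₂⟩, ha⟩ ⟨⟨b₁, b₂⟩, hb⟩ hab
    simp only [adjacentPairs, Finset.mem_erase, Finset.mem_filter, Finset.mem_univ, true_and, ne_eq,
      Subtype.mk.injEq, Prod.mk.injEq] at hab ha hb
    obtain ⟨hne, h | h | h | h⟩ := hab <;> subst h <;> simp only [hI]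
    · exact h2 ha.ne hb.ne fun h => hne ⟨rfl, h.symm⟩
    · simp only [hJsymm (X a₁ _)]
      exact h2 ha.ne' hb.ne (ha.trans hb).ne
    · simp only [hJsymm (X b₁ _)]
      exact h2 ha.ne hb.ne' (hb.trans ha).ne'
    · simp only [hJsymm _ (X b₂ _)]
      exact h2 ha.ne' hb.ne' fun h => hne ⟨h.symm, rfl⟩
  have hmain := abs_prob_forall_eq_zero_sub_exp_le (μ := μ) (I := I)
    (fun a => hJ.comp ((hX.measurable _).prodMk (hX.measurable _)))
    (fun a ω => by
      simp only [hI, hJdef, Set.indicator_apply]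
      split_ifs <;> simp)
    adjacentPairs (fun a => by simp [adjacentPairs])
    (fun a => hX.indepFun_sum_of_disjoint hJ _ _ _ fun b hb => by
      simp only [adjacentPairs, Finset.mem_compl, Finset.mem_filter, Finset.mem_univ, true_and,
        not_or] at hb
      simp only [Finset.mem_insert, Finset.mem_singleton, not_or]
      tauto)
  simp only [h1] at hmain
  have hset : {ω | ∀ a, I a ω = 0} = {ω | ∀ a : {q : Fin p × Fin p // q.1 < q.2},
        |cosAngle (X a.1.1 ω) (X a.1.2 ω)| < t} := by
    ext ω
    simp [hI, hJdef, Set.indicator_apply]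
  rw [hset, Finset.sum_const, Finset.card_univ, nsmul_eq_mul] at hmain
  refine hmain.trans ?_
  rw [← nsmul_eq_mul, ← Finset.card_univ]
  refine Finset.sum_le_card_nsmul _ _ _ fun a _ => ?_
  rw [Finset.sum_congr rfl (h3 a), Finset.sum_const, Finset.sum_const, nsmul_eq_mul, nsmul_eq_mul]
  have c1 : ((adjacentPairs a).card : ℝ) ≤ 4 * p := by exact_mod_cast card_adjacentPairs_le a
  have c2 : (((adjacentPairs a).erase a).card : ℝ) ≤ 4 * p := by
    refine le_trans ?_ c1
    exact_mod_cast Finset.card_erase_le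
  nlinarith [sq_nonneg (capProb k t)]

/-! ### Asymptotics of the normalizing constant -/

/-- Log-convexity at the midpoint of `x` and `x + 1`, with `Γ(x + 1) = x Γ(x)`. -/
lemma Real.Gamma_add_half_le {x : ℝ} (hx : 0 < x) :
    Real.Gamma (x + 1 / 2) ≤ √x * Real.Gamma x := by
  have h := Real.Gamma_mul_add_mul_le_rpow_Gamma_mul_rpow_Gamma hx (by linarith : 0 < x + 1)
    one_half_pos one_half_pos (by norm_num)
  have hG := Real.Gamma_pos_of_pos hx
  rw [Real.Gamma_add_one hx.ne', ← Real.mul_rpow hG.le (by positivity), ← Real.sqrt_eq_rpow,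
    show Real.Gamma x * (x * Real.Gamma x) = x * Real.Gamma x ^ 2 by ring,
    Real.sqrt_mul hx.le, Real.sqrt_sq hG.le] at h
  convert h using 2
  ring

lemma Real.le_Gamma_add_half {x : ℝ} (hx : 0 < x) :
    x * Real.Gamma x ≤ √(x + 1 / 2) * Real.Gamma (x + 1 / 2) := by
  have h := Real.Gamma_add_half_le (by linarith : 0 < x + 1 / 2)
  rwa [show x + 1 / 2 + 1 / 2 = x + 1 by ring, Real.Gamma_add_one hx.ne'] at h

lemma capConst_mul_sqrt (k : ℕ) :
    capConst k * √(k + 1) = 2 / √Real.pi *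
      (Real.Gamma (((k : ℝ) + 2) / 2 + 1 / 2) / Real.Gamma (((k : ℝ) + 2) / 2) / √(k + 1)) := by
  have h1 := Real.Gamma_pos_of_pos (by positivity : 0 < ((k : ℝ) + 2) / 2)
  have h2 := Real.Gamma_pos_of_pos (by positivity : 0 < ((k : ℝ) + 2) / 2 + 1 / 2)
  have hpi := Real.pi_pos
  have hs : √((k : ℝ) + 1) * √((k : ℝ) + 1) = k + 1 := Real.mul_self_sqrt (by positivity)
  have hs0 : 0 < √((k : ℝ) + 1) := Real.sqrt_pos.2 (by positivity)
  rw [capConst, unitBallVolume, unitBallVolume, show (k : ℝ) / 2 + 1 = (k + 2) / 2 by ring,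
    show ((k + 1 : ℕ) : ℝ) / 2 + 1 = (k + 2) / 2 + 1 / 2 by push_cast; ring]
  set r := √((k : ℝ) + 1)
  rw [← hs]
  field_simp
  ring

/-- With `x = (k + 2) / 2`, the ratio `Γ(x + 1/2) / Γ(x)` lies between `x / √(x + 1/2)` and `√x`;
both are asymptotic to `√((k + 1) / 2)`. -/
lemma tendsto_capConst_mul_sqrt :
    Tendsto (fun k : ℕ => capConst k * √(k + 1)) atTop (𝓝 √(2 / Real.pi)) := by
  have hlim : Tendsto (fun k : ℕ => ((k : ℝ) + 2) / 2 / (k + 1)) atTop (𝓝 (1 / 2)) := by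
    have h := (tendsto_one_div_add_atTop_nhds_zero_nat (𝕜 := ℝ)).const_mul (1 / 2) |>.const_add
      (1 / 2)
    rw [mul_zero, add_zero] at h
    refine h.congr fun k => ?_
    field_simp
    ring
  have hlim' : Tendsto (fun k : ℕ => (((k : ℝ) + 2) / 2 + 1 / 2) / (k + 1)) atTop (𝓝 (1 / 2)) := by
    have h := (tendsto_one_div_add_atTop_nhds_zero_nat (𝕜 := ℝ)).const_mul 1 |>.const_add (1 / 2)
    rw [mul_zero, add_zero] at h
    refine h.congr fun k => ?_
    field_simp
    ring
  have hs : √(1 / 2 : ℝ) * √(1 / 2) = 1 / 2 := Real.mul_self_sqrt (by norm_num)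
  have hs0 : √(1 / 2 : ℝ) ≠ 0 := by positivity
  have hG : Tendsto (fun k : ℕ => Real.Gamma (((k : ℝ) + 2) / 2 + 1 / 2) /
      Real.Gamma (((k : ℝ) + 2) / 2) / √(k + 1)) atTop (𝓝 √(1 / 2)) := by
    refine tendsto_of_tendsto_of_tendsto_of_le_of_le
      (g := fun k : ℕ => ((k : ℝ) + 2) / 2 / (k + 1) / √((((k : ℝ) + 2) / 2 + 1 / 2) / (k + 1)))
      (h := fun k : ℕ => √(((k : ℝ) + 2) / 2 / (k + 1))) ?_ hlim.sqrt ?_ ?_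
    · have := hlim.div hlim'.sqrt hs0
      rwa [show (1 / 2 : ℝ) / √(1 / 2) = √(1 / 2) by rw [div_eq_iff hs0, hs]] at this
    · intro k
      have hx : 0 < ((k : ℝ) + 2) / 2 := by positivity
      have h1 := Real.Gamma_pos_of_pos hx
      have h2 := Real.le_Gamma_add_half hx
      have hr : 0 < √((k : ℝ) + 1) := Real.sqrt_pos.2 (by positivity)
      have hr2 : √((k : ℝ) + 1) * √((k : ℝ) + 1) = k + 1 := Real.mul_self_sqrt (by positivity)
      have hq : 0 < √(((k : ℝ) + 2) / 2 + 1 / 2) := Real.sqrt_pos.2 (by positivity)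
      simp only
      rw [Real.sqrt_div (by positivity)]
      nth_rw 1 [← hr2]
      rw [show ((k : ℝ) + 2) / 2 / (√((k : ℝ) + 1) * √((k : ℝ) + 1)) /
        (√(((k : ℝ) + 2) / 2 + 1 / 2) / √((k : ℝ) + 1)) =
          ((k : ℝ) + 2) / 2 / √(((k : ℝ) + 2) / 2 + 1 / 2) / √((k : ℝ) + 1) by field_simp]
      gcongr ?_ / _
      rw [div_le_div_iff₀ hq h1]
      linarith
    · intro k
      have hx : 0 < ((k : ℝ) + 2) / 2 := by positivity
      have h1 := Real.Gamma_pos_of_pos hx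
      simp only
      rw [Real.sqrt_div hx.le]
      gcongr
      rw [div_le_iff₀ h1]
      exact Real.Gamma_add_half_le hx
  have h := hG.const_mul (2 / √Real.pi)
  have he : 2 / √Real.pi * √(1 / 2) = √(2 / Real.pi) := by
    rw [Real.sqrt_div zero_le_two, Real.sqrt_div zero_le_one, Real.sqrt_one]
    have h2 : √(2 : ℝ) * √2 = 2 := Real.mul_self_sqrt zero_le_two
    nth_rw 1 [← h2]
    field_simp
  rw [he] at h
  exact h.congr fun k => (capConst_mul_sqrt k).symm

lemma tendsto_log_succ_div :
    Tendsto (fun k : ℕ => Real.log ((k : ℝ) + 1) / (k + 1)) atTop (𝓝 0) := by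
  have h := Real.isLittleO_log_id_atTop.tendsto_div_nhds_zero.comp
    (tendsto_atTop_add_const_right atTop (1 : ℝ) tendsto_natCast_atTop_atTop)
  exact h

/-! ### Asymptotics of the level and of the mean number of pairs -/

/-- The value of `1 - L²` at which the normalized logarithm of the coherence `L` of `m` vectors of
`ℝᵏ⁺¹` equals `y`. -/
noncomputable def tailLevel (k m : ℕ) (y : ℝ) : ℝ :=
  Real.exp ((y + Real.log ((k : ℝ) + 1) - 4 * ((k : ℝ) + 1) / k * Real.log m) / ((k : ℝ) + 1))

section Asymptotics

variable {m : ℕ → ℕ}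

lemma tendsto_log_atTop_of_div
    (hm : Tendsto (fun k : ℕ => Real.log (m k) / ((k : ℝ) + 1)) atTop atTop) :
    Tendsto (fun k => Real.log (m k)) atTop atTop := by
  refine tendsto_atTop_mono (fun k => ?_) hm
  exact div_le_self (Real.log_natCast_nonneg _) (by linarith [Nat.cast_nonneg (α := ℝ) k])

lemma tendsto_atTop_of_log_div
    (hm : Tendsto (fun k : ℕ => Real.log (m k) / ((k : ℝ) + 1)) atTop atTop) :
    Tendsto (fun k => (m k : ℝ)) atTop atTop :=
  tendsto_atTop_mono (fun _ => Real.log_le_self (Nat.cast_nonneg _)) (tendsto_log_atTop_of_div hm)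

/-- This is where `log p / n → ∞` makes the threshold tend to 1: the term in `log m` dominates the
exponent. -/
lemma tendsto_tailLevel
    (hm : Tendsto (fun k : ℕ => Real.log (m k) / ((k : ℝ) + 1)) atTop atTop) (y : ℝ) :
    Tendsto (fun k => tailLevel k (m k) y) atTop (𝓝 0) := by
  refine Real.tendsto_exp_atBot.comp ?_
  have h1 : Tendsto (fun k : ℕ => y * (1 / ((k : ℝ) + 1)) +
      Real.log ((k : ℝ) + 1) / ((k : ℝ) + 1)) atTop (𝓝 (y * 0 + 0)) :=
    (tendsto_one_div_add_atTop_nhds_zero_nat.const_mul y).add tendsto_log_succ_div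
  refine tendsto_atBot_mono' _ ?_ (h1.add_atBot (tendsto_neg_atTop_atBot.comp hm))
  filter_upwards [eventually_ge_atTop 1] with k hk
  have hk' : (1 : ℝ) ≤ k := by exact_mod_cast hk
  have hl := Real.log_natCast_nonneg (m k)
  have e : (y + Real.log ((k : ℝ) + 1) - 4 * ((k : ℝ) + 1) / k * Real.log (m k)) / ((k : ℝ) + 1) =
      y * (1 / ((k : ℝ) + 1)) + Real.log ((k : ℝ) + 1) / ((k : ℝ) + 1) -
        4 / k * Real.log (m k) := by
    field_simp
  rw [e, Function.comp_apply, ← sub_eq_add_neg]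
  refine sub_le_sub_left ?_ _
  rw [div_mul_eq_mul_div, div_le_div_iff₀ (by positivity) (by positivity)]
  nlinarith

/-- The centring coefficient `4 n / (n - 1)`, with `n = k + 1`, is what makes the power of `m`
exactly `-2`. The rest of the exponent uses `k / (k + 1) = 1 - 1 / (k + 1)`. -/
lemma sqrt_tailLevel_pow {k m : ℕ} (hk : 1 ≤ k) (hm : 1 ≤ m) (y : ℝ) :
    √(tailLevel k m y) ^ k = √((k : ℝ) + 1) / (m : ℝ) ^ 2 *
      Real.exp (y / 2 - 1 / 2 * (y * (1 / ((k : ℝ) + 1)) +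
        Real.log ((k : ℝ) + 1) / ((k : ℝ) + 1))) := by
  have hk' : (0 : ℝ) < k := by exact_mod_cast hk
  have hm' : (0 : ℝ) < m := by exact_mod_cast hm
  have h1 : √((k : ℝ) + 1) = Real.exp (Real.log ((k : ℝ) + 1) / 2) := by
    rw [Real.exp_half, Real.exp_log (by positivity)]
  have h2 : (m : ℝ) ^ 2 = Real.exp (2 * Real.log m) := by
    rw [show 2 * Real.log m = Real.log m + Real.log m by ring, Real.exp_add, Real.exp_log hm', sq]
  rw [tailLevel, ← Real.exp_half, ← Real.exp_nat_mul, h1, h2, ← Real.exp_sub, ← Real.exp_add]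
  congr 1
  field_simp
  ring

lemma tendsto_card_pairs_div_sq (hm : Tendsto (fun k => (m k : ℝ)) atTop atTop) :
    Tendsto (fun k => (Fintype.card {q : Fin (m k) × Fin (m k) // q.1 < q.2} : ℝ) / (m k : ℝ) ^ 2)
      atTop (𝓝 (1 / 2)) := by
  have h := (hm.inv_tendsto_atTop.const_sub 1).mul_const (1 / 2)
  rw [sub_zero, one_mul] at h
  refine h.congr' ?_
  filter_upwards [hm.eventually_ge_atTop 1] with k hk
  have hk' : 1 ≤ m k := by exact_mod_cast hk
  have hc : (Fintype.card {q : Fin (m k) × Fin (m k) // q.1 < q.2} : ℝ) * 2 =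
      m k * (m k - 1) := by
    have h := congrArg (Nat.cast (R := ℝ)) (card_pairs_mul_two (m k))
    push_cast [Nat.cast_sub hk'] at h
    exact h
  have hc' : (Fintype.card {q : Fin (m k) × Fin (m k) // q.1 < q.2} : ℝ) =
      m k * (m k - 1) / 2 := by linarith
  rw [hc', Pi.inv_apply]
  field_simp

lemma tendsto_card_pairs_mul_capProb
    (hm : Tendsto (fun k : ℕ => Real.log (m k) / ((k : ℝ) + 1)) atTop atTop) (y : ℝ) :
    Tendsto (fun k => (Fintype.card {q : Fin (m k) × Fin (m k) // q.1 < q.2} : ℝ) *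
      capProb k √(1 - tailLevel k (m k) y)) atTop
      (𝓝 (1 / √(2 * Real.pi) * Real.exp (y / 2))) := by
  have hm' := tendsto_atTop_of_log_div hm
  have hδ := tendsto_tailLevel hm y
  have hexp : Tendsto (fun k : ℕ => Real.exp (y / 2 - 1 / 2 * (y * (1 / ((k : ℝ) + 1)) +
      Real.log ((k : ℝ) + 1) / ((k : ℝ) + 1)))) atTop (𝓝 (Real.exp (y / 2))) := by
    have h1 := ((tendsto_one_div_add_atTop_nhds_zero_nat (𝕜 := ℝ)).const_mul y).add
      tendsto_log_succ_div
    have h2 := (h1.const_mul (1 / 2)).const_sub (y / 2)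
    simp only [mul_zero, add_zero, sub_zero] at h2
    exact (Real.continuous_exp.tendsto _).comp h2
  have hmain : Tendsto (fun k => (Fintype.card {q : Fin (m k) × Fin (m k) // q.1 < q.2} : ℝ) *
      (capConst k * √(tailLevel k (m k) y) ^ k)) atTop
      (𝓝 (1 / √(2 * Real.pi) * Real.exp (y / 2))) := by
    have h := ((tendsto_card_pairs_div_sq hm').mul tendsto_capConst_mul_sqrt).mul hexp
    have hc : 1 / 2 * √(2 / Real.pi) = 1 / √(2 * Real.pi) := by
      have h2 : √(2 : ℝ) * √2 = 2 := Real.mul_self_sqrt zero_le_two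
      have hpi := Real.pi_pos
      rw [Real.sqrt_div zero_le_two, Real.sqrt_mul zero_le_two]
      nth_rw 1 [← h2]
      field_simp
    rw [hc] at h
    refine h.congr' ?_
    filter_upwards [hm'.eventually_ge_atTop 1, eventually_ge_atTop 1] with k hk hk1
    rw [sqrt_tailLevel_pow hk1 (by exact_mod_cast hk) y]
    ring
  have ht : Tendsto (fun k => √(1 - tailLevel k (m k) y)) atTop (𝓝 1) := by
    simpa using (hδ.const_sub 1).sqrt
  have hlo := hmain.mul ht
  have hhi := hmain.div ht one_ne_zero
  rw [mul_one] at hlo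
  rw [div_one] at hhi
  have hev : ∀ᶠ k in atTop, 1 ≤ k ∧ tailLevel k (m k) y < 1 :=
    (eventually_ge_atTop 1).and (hδ.eventually_lt_const one_pos)
  have hsq : ∀ {k : ℕ}, tailLevel k (m k) y < 1 →
      1 - √(1 - tailLevel k (m k) y) ^ 2 = tailLevel k (m k) y := fun h => by
    rw [Real.sq_sqrt (by linarith)]
    ring
  have hle : ∀ k : ℕ, √(1 - tailLevel k (m k) y) ≤ 1 := fun k => by
    rw [Real.sqrt_le_one]
    have : 0 < tailLevel k (m k) y := Real.exp_pos _
    linarith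
  refine tendsto_of_tendsto_of_tendsto_of_le_of_le' hlo hhi ?_ ?_
  · filter_upwards [hev] with k ⟨hk, h1⟩
    have h := capProb_ge hk (Real.sqrt_pos.2 (by linarith)) (hle k)
    rw [hsq h1] at h
    rw [mul_assoc]
    exact mul_le_mul_of_nonneg_left h (Nat.cast_nonneg _)
  · filter_upwards [hev] with k ⟨hk, h1⟩
    have h := capProb_le hk (Real.sqrt_pos.2 (by linarith)) (hle k)
    rw [hsq h1] at h
    rw [Pi.div_apply, mul_div_assoc]
    exact mul_le_mul_of_nonneg_left h (Nat.cast_nonneg _)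

/-- With `N` pairs and `q` the cap probability, the quantity is `8 (N q) ^ 2 / (N / m ^ 2) / m`, and
`N q` and `N / m ^ 2` have finite limits, the latter nonzero. -/
lemma tendsto_card_pairs_mul_capProb_sq
    (hm : Tendsto (fun k : ℕ => Real.log (m k) / ((k : ℝ) + 1)) atTop atTop) (y : ℝ) :
    Tendsto (fun k => (Fintype.card {q : Fin (m k) × Fin (m k) // q.1 < q.2} : ℝ) *
      (8 * m k * capProb k √(1 - tailLevel k (m k) y) ^ 2)) atTop (𝓝 0) := by
  have hm' := tendsto_atTop_of_log_div hm
  have h := ((((tendsto_card_pairs_mul_capProb hm y).pow 2).div (tendsto_card_pairs_div_sq hm')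
    (by norm_num)).mul hm'.inv_tendsto_atTop).const_mul 8
  rw [mul_zero, mul_zero] at h
  refine h.congr' ?_
  filter_upwards [hm'.eventually_ge_atTop 2] with k hk
  have hk' : 2 ≤ m k := by exact_mod_cast hk
  have hc : (Fintype.card {q : Fin (m k) × Fin (m k) // q.1 < q.2} : ℝ) ≠ 0 := by
    have : Nonempty {q : Fin (m k) × Fin (m k) // q.1 < q.2} :=
      ⟨⟨(⟨0, by omega⟩, ⟨1, by omega⟩), by simp⟩⟩
    exact_mod_cast Fintype.card_ne_zero
  simp only [Pi.inv_apply, Pi.div_apply]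
  field_simp

end Asymptotics

/-! ### The coherence and its logarithmic statistic -/

section Coherence

variable {Ω : Type*} [MeasurableSpace Ω] {μ : Measure Ω} {n p : ℕ}

lemma abs_corrTilde_le_one (Y Z : Ω → EuclideanSpace ℝ (Fin n)) (ω : Ω) :
    |corrTilde μ Y Z ω| ≤ 1 :=
  abs_real_inner_div_norm_mul_norm_le_one _ _

lemma coherenceTilde_nonneg (X : Fin p → Ω → EuclideanSpace ℝ (Fin n)) (ω : Ω) :
    0 ≤ coherenceTilde μ X ω :=
  Real.iSup_nonneg fun _ => abs_nonneg _

lemma coherenceTilde_le_one (X : Fin p → Ω → EuclideanSpace ℝ (Fin n)) (ω : Ω) :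
    coherenceTilde μ X ω ≤ 1 :=
  Real.iSup_le (fun _ => abs_corrTilde_le_one _ _ _) zero_le_one

lemma measurable_coherenceTilde {X : Fin p → Ω → EuclideanSpace ℝ (Fin n)}
    (hX : ∀ i, Measurable (X i)) : Measurable (coherenceTilde μ X) := by
  refine Measurable.iSup fun q => continuous_abs.measurable.comp ?_
  unfold corrTilde
  have h1 := (hX q.1.1).sub_const (meanOrZero μ (X q.1.1))
  have h2 := (hX q.1.2).sub_const (meanOrZero μ (X q.1.2))
  exact (h1.inner h2).div (h1.norm.mul h2.norm)

/-- The centred logarithm of `1 - L²`, where `L` is the coherence. -/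
noncomputable def logCoherenceStat (μ : Measure Ω) (X : Fin p → Ω → EuclideanSpace ℝ (Fin n))
    (ω : Ω) : ℝ :=
  n * Real.log (1 - coherenceTilde μ X ω ^ 2) + 4 * n / ((n : ℝ) - 1) * Real.log p - Real.log n

lemma measurable_logCoherenceStat {X : Fin p → Ω → EuclideanSpace ℝ (Fin n)}
    (hX : ∀ i, Measurable (X i)) : Measurable (logCoherenceStat μ X) := by
  have := measurable_coherenceTilde (μ := μ) hX
  unfold logCoherenceStat
  fun_prop

end Coherence

section Coherence

variable {Ω : Type*} [MeasurableSpace Ω] {μ : Measure Ω} [IsProbabilityMeasure μ] {k p : ℕ}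
  {X : Fin p → Ω → EuclideanSpace ℝ (Fin (k + 1))}

/-- Excludes `L = 1`, where the convention `Real.log 0 = 0` would spoil the equivalence between the
statistic and the threshold. It needs dimension at least 2. -/
lemma IndepSphericalColumns.ae_abs_cosAngle_lt_one (hX : IndepSphericalColumns μ X) (hk : 1 ≤ k) :
    ∀ᵐ ω ∂μ, ∀ a : {q : Fin p × Fin p // q.1 < q.2}, |cosAngle (X a.1.1 ω) (X a.1.2 ω)| < 1 := by
  rw [ae_all_iff]
  intro a
  have h0 : capProb k 1 = 0 := by
    refine le_antisymm ?_ measureReal_nonneg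
    have := capProb_le hk one_pos le_rfl
    simpa [zero_pow (by omega : k ≠ 0)] using this
  have h1 := hX.prob_le_abs_cosAngle 1 a.2.ne
  rw [h0, measureReal_eq_zero_iff] at h1
  rw [ae_iff]
  simpa only [not_lt] using h1

lemma IndepSphericalColumns.prob_logCoherenceStat_le (hX : IndepSphericalColumns μ X) (hk : 1 ≤ k)
    (hp : 2 ≤ p) (y : ℝ) :
    μ.real {ω | logCoherenceStat μ X ω ≤ y} =
      1 - μ.real {ω | ∀ a : {q : Fin p × Fin p // q.1 < q.2},
        |cosAngle (X a.1.1 ω) (X a.1.2 ω)| < √(1 - tailLevel k p y)} := by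
  have hne : Nonempty {q : Fin p × Fin p // q.1 < q.2} :=
    ⟨⟨(⟨0, by omega⟩, ⟨1, by omega⟩), by simp⟩⟩
  have hmeas : MeasurableSet {ω | ∀ a : {q : Fin p × Fin p // q.1 < q.2},
      |cosAngle (X a.1.1 ω) (X a.1.2 ω)| < √(1 - tailLevel k p y)} := by
    rw [Set.ofPred_forall]
    refine MeasurableSet.iInter fun a => ?_
    have := (hX.measurableSet_le_abs_cosAngle √(1 - tailLevel k p y) a.1.1 a.1.2).compl
    simpa only [Set.compl_ofPred, not_le] using this
  rw [← probReal_compl_eq_one_sub hmeas]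
  refine measureReal_congr ?_
  filter_upwards [hX.ae_abs_cosAngle_lt_one hk] with ω hω
  have hk0 : (0 : ℝ) < (k : ℝ) + 1 := by positivity
  have hL : coherenceTilde μ X ω = ⨆ a : {q : Fin p × Fin p // q.1 < q.2},
      |cosAngle (X a.1.1 ω) (X a.1.2 ω)| := by
    simp only [coherenceTilde, hX.corrTilde_eq]
  obtain ⟨a₀, ha₀⟩ := exists_eq_ciSup_of_finite
    (f := fun a : {q : Fin p × Fin p // q.1 < q.2} => |cosAngle (X a.1.1 ω) (X a.1.2 ω)|)
  have hL0 := coherenceTilde_nonneg (μ := μ) X ω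
  have hL1 : coherenceTilde μ X ω < 1 := by
    rw [hL, ← ha₀]
    exact hω a₀
  have hpos : 0 < 1 - coherenceTilde μ X ω ^ 2 := by nlinarith
  -- No bound on `tailLevel` is needed: if it exceeds 1 the root is 0 and both sides hold.
  have hiff : logCoherenceStat μ X ω ≤ y ↔ √(1 - tailLevel k p y) ≤ coherenceTilde μ X ω := by
    rw [Real.sqrt_le_left hL0, sub_le_comm, tailLevel, ← Real.log_le_iff_le_exp hpos,
      le_div_iff₀ hk0, logCoherenceStat]
    push_cast
    rw [add_sub_cancel_right]
    constructor <;> intro h <;> linarith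
  have hiff2 : √(1 - tailLevel k p y) ≤ coherenceTilde μ X ω ↔
      ∃ a : {q : Fin p × Fin p // q.1 < q.2},
        √(1 - tailLevel k p y) ≤ |cosAngle (X a.1.1 ω) (X a.1.2 ω)| := by
    rw [hL]
    refine ⟨fun h => ⟨a₀, ha₀ ▸ h⟩, fun ⟨a, ha⟩ => ha.trans ?_⟩
    exact le_ciSup (f := fun a : {q : Fin p × Fin p // q.1 < q.2} =>
      |cosAngle (X a.1.1 ω) (X a.1.2 ω)|) (Set.finite_range _).bddAbove a
  refine propext ?_
  change logCoherenceStat μ X ω ≤ y ↔ ¬ ∀ a : {q : Fin p × Fin p // q.1 < q.2},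
        |cosAngle (X a.1.1 ω) (X a.1.2 ω)| < √(1 - tailLevel k p y)
  rw [hiff, hiff2]
  push Not
  rfl

end Coherence

/-! ### Limit of the distribution functions, tightness and laws of large numbers -/

section Limits

variable {Ω : ℕ → Type*} [∀ n, MeasurableSpace (Ω n)] {μ : ∀ n, Measure (Ω n)}
  [∀ n, IsProbabilityMeasure (μ n)]

/-- The distribution functions of the centred logarithms of the coherences converge. -/
theorem tendsto_prob_logCoherenceStat_le {p : ℕ → ℕ}
    {X : ∀ n, Fin (p n) → Ω n → EuclideanSpace ℝ (Fin n)}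
    (hX : ∀ n, 1 ≤ n → IndepSphericalColumns (μ n) (X n))
    (hp : Tendsto (fun n : ℕ => Real.log (p n) / n) atTop atTop) (y : ℝ) :
    Tendsto (fun n => (μ n).real {ω | logCoherenceStat (μ n) (X n) ω ≤ y}) atTop
      (𝓝 (1 - Real.exp (-(1 / √(2 * Real.pi) * Real.exp (y / 2))))) := by
  -- Shift to `n = k + 1`, so that the slices have dimension `k = n - 1`.
  rw [← tendsto_add_atTop_iff_nat 1]
  have hm : Tendsto (fun k : ℕ => Real.log (p (k + 1)) / ((k : ℝ) + 1)) atTop atTop := by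
    have := (tendsto_add_atTop_iff_nat 1).2 hp
    simpa only [Nat.cast_add, Nat.cast_one] using this
  have hlim : Tendsto (fun k => (μ (k + 1)).real
      {ω | ∀ a : {q : Fin (p (k + 1)) × Fin (p (k + 1)) // q.1 < q.2},
        |cosAngle (X (k + 1) a.1.1 ω) (X (k + 1) a.1.2 ω)| <
          √(1 - tailLevel k (p (k + 1)) y)}) atTop
      (𝓝 (Real.exp (-(1 / √(2 * Real.pi) * Real.exp (y / 2))))) := by
    have h1 := (Real.continuous_exp.tendsto _).comp (tendsto_card_pairs_mul_capProb hm y).neg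
    refine tendsto_of_tendsto_of_dist h1 ?_
    refine squeeze_zero (fun _ => dist_nonneg) (fun k => ?_)
      (tendsto_card_pairs_mul_capProb_sq hm y)
    rw [dist_comm, Real.dist_eq]
    exact (hX (k + 1) (by omega)).abs_prob_forall_abs_cosAngle_lt_sub_exp_le _
  refine (hlim.const_sub 1).congr' ?_
  filter_upwards [eventually_ge_atTop 1,
    (tendsto_atTop_of_log_div hm).eventually_ge_atTop 2] with k hk h2
  exact ((hX (k + 1) (by omega)).prob_logCoherenceStat_le hk (by exact_mod_cast h2) y).symm

/-- A sequence of random variables whose distribution functions converge to that of a probability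
measure is bounded in probability. -/
lemma tendsto_measure_le_abs_of_tendsto_cdf {Y : ∀ n, Ω n → ℝ} (hY : ∀ n, Measurable (Y n))
    {ν : Measure ℝ} [IsProbabilityMeasure ν]
    (h : ∀ y, Tendsto (fun n => (μ n).real {ω | Y n ω ≤ y}) atTop (𝓝 (cdf ν y)))
    {b : ℕ → ℝ} (hb : Tendsto b atTop atTop) :
    Tendsto (fun n => (μ n).real {ω | b n ≤ |Y n ω|}) atTop (𝓝 0) := by
  refine tendsto_order.2 ⟨fun c hc => .of_forall fun n => hc.trans_le measureReal_nonneg,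
    fun η hη => ?_⟩
  have hlim : Tendsto (fun M : ℝ => cdf ν (-M) + (1 - cdf ν M)) atTop (𝓝 0) := by
    have := ((tendsto_cdf_atBot ν).comp tendsto_neg_atTop_atBot).add
      ((tendsto_cdf_atTop ν).const_sub 1)
    simpa using this
  obtain ⟨M, hM⟩ := (hlim.eventually_lt_const hη).exists
  filter_upwards [((h (-M)).add ((h M).const_sub 1)).eventually_lt_const hM,
    hb.eventually_gt_atTop M] with n hn hbn
  refine lt_of_le_of_lt ?_ hn
  have hs : MeasurableSet {ω | Y n ω ≤ M} := measurableSet_le (hY n) measurable_const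
  rw [← probReal_compl_eq_one_sub hs]
  refine (measureReal_mono ?_).trans (measureReal_union_le _ _)
  intro ω hω
  simp only [Set.mem_ofPred_eq, Set.mem_union, Set.mem_compl_iff, not_le] at hω ⊢
  rcases le_abs.1 (hbn.le.trans hω) with h | h
  · rcases le_abs.1 hω with h' | h'
    · exact .inr (hbn.trans_le h')
    · exact .inl (by linarith)
  · exact .inl (by linarith)

end Limits

section LawOfLargeNumbers

variable {Ω : ℕ → Type*} [∀ n, MeasurableSpace (Ω n)] {μ : ∀ n, Measure (Ω n)} {p : ℕ → ℕ}
  {X : ∀ n, Fin (p n) → Ω n → EuclideanSpace ℝ (Fin n)}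

lemma tendstoInProb_of_eventually_subset [∀ n, IsProbabilityMeasure (μ n)] {Y : ∀ n, Ω n → ℝ}
    {c : ℝ} (h : ∀ ε : ℝ, 0 < ε → ∃ S : ∀ n, Set (Ω n),
      Tendsto (fun n => (μ n).real (S n)) atTop (𝓝 0) ∧
      ∀ᶠ n in atTop, {ω | ε ≤ |Y n ω - c|} ⊆ S n) : TendstoInProb μ Y c := by
  intro ε hε
  obtain ⟨S, hS, hsub⟩ := h ε hε
  have hS' : Tendsto (fun n => μ n (S n)) atTop (𝓝 0) := by
    have := ENNReal.tendsto_ofReal hS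
    simpa using this
  refine tendsto_of_tendsto_of_tendsto_of_le_of_le' tendsto_const_nhds hS'
    (.of_forall fun _ => zero_le) ?_
  filter_upwards [hsub] with n hn
  exact measure_mono hn

lemma tendstoInProb_log_one_sub_coherenceTilde_sq [∀ n, IsProbabilityMeasure (μ n)]
    (hp : Tendsto (fun n : ℕ => Real.log (p n) / n) atTop atTop)
    (hZ : ∀ b : ℕ → ℝ, Tendsto b atTop atTop →
      Tendsto (fun n => (μ n).real {ω | b n ≤ |logCoherenceStat (μ n) (X n) ω|}) atTop (𝓝 0)) :
    TendstoInProb μ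
      (fun n ω => n / Real.log (p n) * Real.log (1 - coherenceTilde (μ n) (X n) ω ^ 2)) (-4) := by
  have hlog : Tendsto (fun n : ℕ => Real.log (p n)) atTop atTop := by
    refine tendsto_atTop_mono' _ ?_ hp
    filter_upwards [eventually_ge_atTop 1] with n hn
    exact div_le_self (Real.log_natCast_nonneg _) (by exact_mod_cast hn)
  have h1 : Tendsto (fun n : ℕ => Real.log n / Real.log (p n)) atTop (𝓝 0) := by
    have ha : Tendsto (fun n : ℕ => Real.log n / n) atTop (𝓝 0) :=
      Real.isLittleO_log_id_atTop.tendsto_div_nhds_zero.comp tendsto_natCast_atTop_atTop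
    have hb := ha.mul hp.inv_tendsto_atTop
    rw [mul_zero] at hb
    refine hb.congr' ?_
    filter_upwards [eventually_ge_atTop 1] with n hn
    have : (n : ℝ) ≠ 0 := by positivity
    rw [Pi.inv_apply]
    field_simp
  have h2 : Tendsto (fun n : ℕ => 4 / ((n : ℝ) - 1)) atTop (𝓝 0) :=
    (tendsto_atTop_add_const_right _ (-1) tendsto_natCast_atTop_atTop).const_div_atTop 4
  have h3 := h1.sub h2
  rw [sub_zero] at h3
  refine tendstoInProb_of_eventually_subset fun ε hε =>
    ⟨fun n => {ω | ε / 2 * Real.log (p n) ≤ |logCoherenceStat (μ n) (X n) ω|},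
      hZ _ (hlog.const_mul_atTop (by positivity)), ?_⟩
  filter_upwards [h3.abs.eventually_lt_const (by simpa using half_pos hε : |(0 : ℝ)| < ε / 2),
    hlog.eventually_gt_atTop 0, eventually_ge_atTop 2] with n hn hl hn2 ω hω
  have hn2' : (0 : ℝ) < n - 1 := by
    have : (2 : ℝ) ≤ n := by exact_mod_cast hn2
    linarith
  -- After division by `log p` the centring leaves `4 n / (n - 1) - 4 = 4 / (n - 1)`, which vanishes
  -- in the limit together with `log n / log p`.
  have key : n / Real.log (p n) * Real.log (1 - coherenceTilde (μ n) (X n) ω ^ 2) - -4 =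
      logCoherenceStat (μ n) (X n) ω / Real.log (p n) +
        (Real.log n / Real.log (p n) - 4 / ((n : ℝ) - 1)) := by
    rw [logCoherenceStat]
    field_simp
    ring
  simp only [Set.mem_ofPred_eq, key] at hω ⊢
  have h5 := (hω.trans (abs_add_le _ _))
  rw [abs_div, abs_of_pos hl] at h5
  rw [← le_div_iff₀ hl]
  linarith

lemma tendstoInProb_coherenceTilde [∀ n, IsProbabilityMeasure (μ n)]
    (hp : Tendsto (fun n : ℕ => Real.log (p n) / n) atTop atTop)
    (hT : TendstoInProb μ
      (fun n ω => n / Real.log (p n) * Real.log (1 - coherenceTilde (μ n) (X n) ω ^ 2)) (-4)) :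
    TendstoInProb μ (fun n ω => coherenceTilde (μ n) (X n) ω) 1 := by
  -- Off the exceptional event with tolerance 1, the normalized logarithm is below `-3`, so `1 - L ≤
  -- 1 - L ^ 2 < exp (-3 log p / n)`, which is eventually below `ε`.
  refine tendstoInProb_of_eventually_subset fun ε hε => 
    ⟨_, (ENNReal.tendsto_toReal ENNReal.zero_ne_top).comp (hT 1 one_pos), ?_⟩
  have h1 : Tendsto (fun n : ℕ => Real.exp (-(3 * (Real.log (p n) / n)))) atTop (𝓝 0) :=
    Real.tendsto_exp_neg_atTop_nhds_zero.comp (hp.const_mul_atTop three_pos)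
  filter_upwards [h1.eventually_lt_const hε, hp.eventually_gt_atTop 0,
    eventually_ge_atTop 1] with n hn hl hn1 ω hω
  have hn0 : (0 : ℝ) < n := by exact_mod_cast hn1
  have hl0 : 0 < Real.log (p n) := by
    have := mul_pos hl hn0
    rwa [div_mul_cancel₀ _ hn0.ne'] at this
  have hL0 := coherenceTilde_nonneg (μ := μ n) (X n) ω
  have hL1 := coherenceTilde_le_one (μ := μ n) (X n) ω
  have hL2 : 0 ≤ 1 - coherenceTilde (μ n) (X n) ω ^ 2 := by nlinarith
  by_contra hcon
  simp only [Set.mem_ofPred_eq, not_le] at hω hcon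
  have h4 : n / Real.log (p n) * Real.log (1 - coherenceTilde (μ n) (X n) ω ^ 2) < -3 := by
    have := (abs_lt.1 hcon).2
    linarith
  have h5 : Real.log (1 - coherenceTilde (μ n) (X n) ω ^ 2) < -(3 * (Real.log (p n) / n)) := by
    rw [div_mul_eq_mul_div, div_lt_iff₀ hl0] at h4
    rw [← mul_div_assoc, ← neg_div, lt_div_iff₀ hn0]
    linarith
  -- At `L = 1` the logarithm would be 0 by convention, contradicting its negative upper bound.
  have hpos : 0 < 1 - coherenceTilde (μ n) (X n) ω ^ 2 := by
    refine hL2.lt_of_ne fun h => ?_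
    rw [← h, Real.log_zero] at h5
    linarith
  have h6 := (Real.log_lt_iff_lt_exp hpos).1 h5
  rw [abs_sub_comm, abs_of_nonneg (by linarith)] at hω
  nlinarith

end LawOfLargeNumbers

/-! ### The main theorem -/

theorem mainTheorem7 {Ω : ℕ → Type*} [∀ n, MeasurableSpace (Ω n)]
    (μ : ∀ n, Measure (Ω n)) [∀ n, IsProbabilityMeasure (μ n)]
    (p : ℕ → ℕ)
    (X : ∀ n, Fin (p n) → Ω n → EuclideanSpace ℝ (Fin n))
    (hX : ∀ n, 1 ≤ n → IndepSphericalColumns (μ n) (X n))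
    (hp : Tendsto (fun n : ℕ => Real.log (p n) / n) atTop atTop) :
    TendstoInProb μ (fun n ω => coherenceTilde (μ n) (X n) ω) 1 ∧
    TendstoInProb μ
      (fun n ω => n / Real.log (p n) * Real.log (1 - coherenceTilde (μ n) (X n) ω ^ 2)) (-4) ∧
    ∃ (ν : Measure ℝ) (_ : IsProbabilityMeasure ν),
      (∀ y : ℝ, cdf ν y =
        1 - Real.exp (-(1 / Real.sqrt (2 * Real.pi) * Real.exp (y / 2)))) ∧
      TendstoInDistribution
        (fun (n : ℕ) (ω : Ω n) =>
          n * Real.log (1 - coherenceTilde (μ n) (X n) ω ^ 2)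
            + 4 * n / ((n : ℝ) - 1) * Real.log (p n) - Real.log n)
        atTop id μ ν := by
  obtain ⟨ν, hν, hcdf⟩ := exists_probabilityMeasure_cdf_eq
    (K := 1 / √(2 * Real.pi)) (by have := Real.pi_pos; positivity)
  have hXm : ∀ n i, Measurable (X n i) := by
    -- For `n = 0` nothing is assumed about the columns, but they take values in a one-point space.
    rintro (_ | n) i
    · exact measurable_of_subsingleton_codomain _
    · exact (hX (n + 1) (by omega)).measurable i
  have hZm : ∀ n, Measurable (logCoherenceStat (μ n) (X n)) := fun n =>
    measurable_logCoherenceStat (hXm n)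
  have hlim : ∀ y, Tendsto (fun n => (μ n).real {ω | logCoherenceStat (μ n) (X n) ω ≤ y}) atTop
      (𝓝 (cdf ν y)) := fun y => by
    rw [hcdf]
    exact tendsto_prob_logCoherenceStat_le hX hp y
  have hT := tendstoInProb_log_one_sub_coherenceTilde_sq hp fun b hb =>
    tendsto_measure_le_abs_of_tendsto_cdf hZm hlim hb
  exact ⟨tendstoInProb_coherenceTilde hp hT, hT, ν, hν, hcdf,
    tendstoInDistribution_of_tendsto_cdf (fun n => (hZm n).aemeasurable) hlim⟩
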